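/- Let $p$ be an odd prime and $s\ge 1$ an integer such that $p^s\equiv 1\pmod 3$, and let $m=(p^s-1)/3$ or $m=p^s-1$. Write $(x)_0=1$ and $(x)_n=x(x+1)\cdots(x+n-1)$ for $n\ge 1$. Then $$\sum_{k=0}^{m}(6k+1)\frac{(1/3)_k^6}{k!^6}\equiv \frac{(2/3)_{(p^s-1)/3}^3}{(1)_{(p^s-1)/3}^3}\left\{p^s+p^{3s}\sum_{j=1}^{(p^s-1)/3}\left(\frac{1}{(3j-1)^2}-\frac{1}{(3j)^2}\right)\right\}\pmod{p^{s+4}},$$ where, for rational numbers $a,b$, the congruence $a\equiv b\pmod{p^{N}}$ means that $a-b=p^{N}r$ for some rational number $r$ whose reduced denominator is not divisible by $p$. -/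

import Mathlib

/-- The rising factorial `(x)_n = x (x + 1) ⋯ (x + n - 1)` of a rational number, `(x)_0 = 1`. -/
noncomputable def shiftedFactorial (x : ℚ) (n : ℕ) : ℚ := (ascPochhammer ℚ n).eval x

/-- `a ≡ b (mod p ^ N)` for rational numbers: `a - b` lies in `p ^ N ℤ_(p)`, where `ℤ_(p)` is the
ring of the rational numbers whose reduced denominator is not divisible by `p`. -/
def RatModEqPrimePow (p N : ℕ) (a b : ℚ) : Prop :=
  ∃ r : ℚ, ¬ p ∣ r.den ∧ a - b = (p : ℚ) ^ N * r

/-!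
Write `p ^ s = N = 3 n + 1` and `A_x(k) = ∏_{i < k} ((3 i + 1)² - x²) / ((3 i + 3)² - x²)`, so that
the left-hand side is `∑ (6 k + 1) A_0(k)³`. Dougall's formula for a terminating very-well-poised
series sums `∑ (6 k + 1) A_0 A_x A_N` in closed form. In `A_0³ = 2 A_0² A_N - A_0 A_N² +
A_0 (A_0 - A_N)²` the first two terms are of this kind, for `x = 0` and `x = N`, and a `p`-adic
expansion of their closed forms gives the right-hand side. The last term contributes a multiple of
`p ^ (s + 4)`. To see this, replace the integers by their `q`-analogues: the resulting rational
function of `q` vanishes at the primitive `p ^ j`-th roots of unity, to order 1 for `0 < j < s` and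
to order 5 for `j = s`. One zero comes from a reflection of the index `k` in each block of `p ^ j`
terms, under which the `q`-analogue of `6 k + 1` is odd and the other factor even; the other four
come from `A_0 - A_N`, which is divisible by the square of the `q`-analogue of `N`. At `q = 1` each
of these zeros yields a factor `Φ_{p ^ j}(1) = p`.
-/

open Polynomial

/-- The product `∏_{i < k} b (3 i + x) / b (3 i + y)`, for a function `b` on the integers that
stands for the integers themselves or for a `q`-analogue of them. -/
def ratioProd {K : Type*} [Field K] (b : ℤ → K) (x y : ℤ) (k : ℕ) : K :=
  ∏ i ∈ Finset.range k, b (3 * i + x) / b (3 * i + y)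

/-- The very-well-poised product `∏_{i < k} (b (3 i + x)² - t) / (b (3 i + 3)² - t)`. -/
def pairedProd {K : Type*} [Field K] (b : ℤ → K) (t : K) (x : ℤ) (k : ℕ) : K :=
  ratioProd (fun z => b z ^ 2 - t) x 3 k

/-- The derivative at `t = 0` of `log (pairedProd b t x k)`. -/
def pairedProdLogDeriv {K : Type*} [Field K] (b : ℤ → K) (x : ℤ) (k : ℕ) : K :=
  ∑ i ∈ Finset.range k, (1 / b (3 * i + 3) ^ 2 - 1 / b (3 * i + x) ^ 2)

/-- The second difference `b (6 k + 1) A (A - B)²`, where `A = pairedProd b 0 1 k` and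
`B = pairedProd b (b c ^ 2) 1 k`. Both are written here through `ratioProd`, in which `B` splits
into two factors. -/
def diffTerm {K : Type*} [Field K] (b : ℤ → K) (c : ℤ) (k : ℕ) : K :=
  b (6 * k + 1) * ratioProd b 1 3 k ^ 2 *
    (ratioProd b 1 3 k ^ 2 - ratioProd b (1 + c) (3 + c) k * ratioProd b (1 - c) (3 - c) k) ^ 2

section RatioProd
variable {K : Type*} [Field K] {b : ℤ → K} {x y : ℤ}

@[simp]
lemma ratioProd_zero (b : ℤ → K) (x y : ℤ) : ratioProd b x y 0 = 1 := rfl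

lemma ratioProd_succ (b : ℤ → K) (x y : ℤ) (k : ℕ) :
    ratioProd b x y (k + 1) = ratioProd b x y k * (b (3 * k + x) / b (3 * k + y)) :=
  Finset.prod_range_succ _ k

lemma ratioProd_add (b : ℤ → K) (x y : ℤ) (k l : ℕ) :
    ratioProd b x y (k + l) = ratioProd b x y k * ratioProd b (x + 3 * k) (y + 3 * k) l := by
  simp only [ratioProd, Finset.prod_range_add]
  congr! 4 <;> push_cast <;> ring

lemma ratioProd_eq_zero {n k : ℕ} (hx : b (3 * n + x) = 0) (hn : n < k) :
    ratioProd b x y k = 0 :=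
  Finset.prod_eq_zero (Finset.mem_range.2 hn) (by rw [hx, zero_div])

@[simp]
lemma pairedProd_zero (b : ℤ → K) (t : K) (x : ℤ) : pairedProd b t x 0 = 1 := rfl

lemma pairedProd_succ (b : ℤ → K) (t : K) (x : ℤ) (k : ℕ) : pairedProd b t x (k + 1) =
    pairedProd b t x k * ((b (3 * k + x) ^ 2 - t) / (b (3 * k + 3) ^ 2 - t)) :=
  ratioProd_succ _ x 3 k

lemma pairedProd_zero_left (b : ℤ → K) (x : ℤ) (k : ℕ) :
    pairedProd b 0 x k = ratioProd b x 3 k ^ 2 := by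
  simp only [pairedProd, ratioProd, sub_zero, ← div_pow, Finset.prod_pow]

lemma ratioProd_succ_eq_mul_prod_erase (b : ℤ → K) (x y : ℤ) {n k : ℕ} (hn : n ≤ k) :
    ratioProd b x y (k + 1) = b (3 * n + x) / b (3 * k + y) *
      ((∏ i ∈ (Finset.range (k + 1)).erase n, b (3 * i + x)) *
        ∏ i ∈ Finset.range k, (b (3 * i + y))⁻¹) := by
  simp only [ratioProd, div_eq_mul_inv, Finset.prod_mul_distrib]
  rw [Finset.prod_range_succ (fun i : ℕ => (b (3 * i + y))⁻¹),
    ← Finset.mul_prod_erase _ _ (Finset.mem_range_succ_iff.2 hn)]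
  ring

lemma pairedProdLogDeriv_succ (b : ℤ → K) (x : ℤ) (k : ℕ) : pairedProdLogDeriv b x (k + 1) =
    pairedProdLogDeriv b x k + (1 / b (3 * k + 3) ^ 2 - 1 / b (3 * k + x) ^ 2) :=
  Finset.sum_range_succ _ k

lemma ratioProd_mul_ratioProd (hb : ∀ x y, b (x + y) * b (x - y) = b x ^ 2 - b y ^ 2)
    (x c : ℤ) (k : ℕ) :
    ratioProd b (x + c) (3 + c) k * ratioProd b (x - c) (3 - c) k = pairedProd b (b c ^ 2) x k := by
  simp only [pairedProd, ratioProd, ← Finset.prod_mul_distrib, div_mul_div_comm, ← hb, add_assoc,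
    add_sub_assoc]

end RatioProd

section Dougall

lemma three_mul_add_one_sub_ne_zero (n k : ℤ) : (3 * n + 1 - 3 * k : ℚ) ≠ 0 := by
  exact_mod_cast (by omega : 3 * n + 1 - 3 * k ≠ 0)

lemma pairedProd_intCast_eq_zero {n k : ℕ} (h : n < k) :
    pairedProd (Int.cast : ℤ → ℚ) ((3 * n + 1 : ℚ) ^ 2) 1 k = 0 :=
  ratioProd_eq_zero (n := n) (by push_cast; ring) h

lemma pairedProd_intCast_contiguous (n k : ℕ) :
    pairedProd (Int.cast : ℤ → ℚ) ((3 * n + 1 : ℚ) ^ 2) 1 k =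
    pairedProd (Int.cast : ℤ → ℚ) ((3 * n + 4 : ℚ) ^ 2) 1 k *
      ((3 * n + 2) * (n + 1 - k) * (3 * n + 1) * (3 * k + (3 * n + 4)) /
        ((3 * k + (3 * n + 2)) * (n + 1) * (3 * n + 1 - 3 * k) * (3 * n + 4))) := by
  have hD (k : ℕ) : (3 * n + 1 - 3 * k : ℚ) ≠ 0 := mod_cast three_mul_add_one_sub_ne_zero n k
  induction k with
  | zero =>
    have := hD 0
    simp only [pairedProd_zero, Nat.cast_zero, mul_zero, sub_zero, zero_add]
    field_simp
  | succ k ih =>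
    have hk := hD k
    have hk' := hD (k + 1)
    have e₁ : (3 * k + 3 : ℚ) ^ 2 - (3 * n + 1) ^ 2 =
      -((3 * k + (3 * n + 4)) * (3 * n + 1 - 3 * (k + 1))) := by ring
    have e₄ : (3 * k + 3 : ℚ) ^ 2 - (3 * n + 4) ^ 2 =
      -((3 * k + (3 * n + 7)) * (3 * n + 1 - 3 * k)) := by ring
    rw [pairedProd_succ, pairedProd_succ, ih]
    push_cast at hk' ⊢
    rw [e₁, e₄]
    generalize pairedProd (Int.cast : ℤ → ℚ) ((3 * n + 4 : ℚ) ^ 2) 1 k = A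
    generalize (3 * n + 1 - 3 * k : ℚ) = D at *
    field_simp
    ring

-- The right-hand side is the telescoping certificate produced by the Wilf-Zeilberger method.
lemma dougall_sum_recurrence {t : ℚ} (ht : ∀ i : ℕ, (3 * i + 3 : ℚ) ^ 2 - t ≠ 0) (n K : ℕ) :
    ∑ k ∈ Finset.range K, (6 * k + 1) * pairedProd Int.cast 0 1 k * pairedProd Int.cast t 1 k *
      (pairedProd Int.cast ((3 * n + 4 : ℚ) ^ 2) 1 k - (3 * n + 4) / (3 * n + 1) *
        ((3 * n + 2) / (3 * n + 3)) * (((3 * n + 2) ^ 2 - t) / ((3 * n + 3) ^ 2 - t)) *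
          pairedProd Int.cast ((3 * n + 1 : ℚ) ^ 2) 1 k) =
    -(6 * n + 5) * K ^ 2 * (9 * K ^ 2 - t) * (3 * K + (3 * n + 4)) /
      ((n + 1) ^ 2 * ((3 * n + 3) ^ 2 - t) * (3 * K + (3 * n + 2))) *
      (pairedProd Int.cast 0 1 K * pairedProd Int.cast t 1 K *
        pairedProd Int.cast ((3 * n + 4 : ℚ) ^ 2) 1 K) := by
  induction K with
  | zero => simp
  | succ k ih =>
    have hn := ht n
    have hk := ht k
    have hD : (3 * n + 1 - 3 * k : ℚ) ≠ 0 := mod_cast three_mul_add_one_sub_ne_zero n k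
    have e₀ : (3 * k + 3 : ℚ) ^ 2 - 0 = 9 * (k + 1) ^ 2 := by ring
    have e₁ : 9 * (k + 1 : ℚ) ^ 2 - t = (3 * k + 3) ^ 2 - t := by ring
    have e₄ : (3 * k + 3 : ℚ) ^ 2 - (3 * n + 4) ^ 2 =
      -((3 * k + (3 * n + 7)) * (3 * n + 1 - 3 * k)) := by ring
    rw [Finset.sum_range_succ, ih, pairedProd_intCast_contiguous]
    simp only [pairedProd_succ]
    push_cast
    rw [e₀, e₁, e₄]
    generalize pairedProd (Int.cast : ℤ → ℚ) 0 1 k = A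
    generalize pairedProd (Int.cast : ℤ → ℚ) t 1 k = B
    generalize pairedProd (Int.cast : ℤ → ℚ) ((3 * n + 4 : ℚ) ^ 2) 1 k = C
    generalize hQ : (3 * k + 3 : ℚ) ^ 2 - t = Q at *
    generalize hP : (3 * n + 3 : ℚ) ^ 2 - t = P at *
    generalize hD' : (3 * n + 1 - 3 * k : ℚ) = D at *
    field_simp
    subst hQ hP hD'
    ring

theorem dougall_sum {t : ℚ} (ht : ∀ i : ℕ, (3 * i + 3 : ℚ) ^ 2 - t ≠ 0) (n : ℕ) :
    ∑ k ∈ Finset.range (n + 1), (6 * k + 1) * pairedProd Int.cast 0 1 k *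
      pairedProd Int.cast t 1 k * pairedProd Int.cast ((3 * n + 1 : ℚ) ^ 2) 1 k =
    (3 * n + 1) * ratioProd Int.cast 2 3 n * pairedProd Int.cast t 2 n := by
  induction n with
  | zero => simp
  | succ n ih =>
    have hN : (3 * (n + 1 : ℕ) + 1 : ℚ) = 3 * n + 4 := by push_cast; ring
    have vanish : pairedProd (Int.cast : ℤ → ℚ) ((3 * n + 4 : ℚ) ^ 2) 1 (n + 2) = 0 :=
      hN ▸ pairedProd_intCast_eq_zero (Nat.lt_succ_self _)
    have recurrence := dougall_sum_recurrence ht n (n + 2)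
    simp only [vanish, mul_zero, mul_sub, Finset.sum_sub_distrib, sub_eq_zero] at recurrence
    rw [hN, recurrence, Finset.sum_range_succ, pairedProd_intCast_eq_zero n.lt_succ_self, mul_zero,
      mul_zero, add_zero, ratioProd_succ, pairedProd_succ]
    calc _ = (3 * n + 4) / (3 * n + 1) * ((3 * n + 2) / (3 * n + 3)) *
          (((3 * n + 2) ^ 2 - t) / ((3 * n + 3) ^ 2 - t)) *
            ((3 * n + 1) * ratioProd Int.cast 2 3 n * pairedProd Int.cast t 2 n) := by
          rw [← ih, Finset.mul_sum]
          exact Finset.sum_congr rfl fun _ _ => by ring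
      _ = _ := by
          push_cast
          field_simp

end Dougall

section Expansion

lemma exists_prod_one_add {R ι : Type*} [CommRing R] {S : Subring R} {t : R} (ht : t ∈ S)
    {s : Finset ι} {f a : ι → R} (ha : ∀ i ∈ s, a i ∈ S)
    (hf : ∀ i ∈ s, ∃ r ∈ S, f i = 1 + t * a i + t ^ 2 * r) :
    ∃ r ∈ S, ∏ i ∈ s, f i = 1 + t * ∑ i ∈ s, a i + t ^ 2 * r := by
  classical
  induction s using Finset.induction_on with
  | empty => exact ⟨0, zero_mem S, by simp⟩
  | insert i s hi ih =>
    rw [Finset.forall_mem_insert] at ha hf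
    obtain ⟨⟨r, hr, hfi⟩, r', hr', hfs⟩ := hf.1, ih ha.2 hf.2
    have hsum : ∑ i ∈ s, a i ∈ S := sum_mem ha.2
    refine ⟨r + r' + (a i + t * r) * (∑ i ∈ s, a i + t * r'), ?_, ?_⟩
    · exact add_mem (add_mem hr hr') (mul_mem (add_mem ha.1 (mul_mem ht hr))
        (add_mem hsum (mul_mem ht hr')))
    · rw [Finset.prod_insert hi, Finset.sum_insert hi, hfi, hfs]
      ring

variable {K : Type*} [Field K] {S : Subring K} {t : K}

lemma exists_one_sub_div_one_sub
    (hinv : ∀ d ∈ S, 1 - t * d ≠ 0 ∧ (1 - t * d)⁻¹ ∈ S) {c d : K} (hc : c ∈ S) (hd : d ∈ S) :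
    ∃ r ∈ S, (1 - t * c) / (1 - t * d) = 1 + t * (d - c) + t ^ 2 * r := by
  obtain ⟨hne, hmem⟩ := hinv d hd
  refine ⟨d * (d - c) * (1 - t * d)⁻¹, mul_mem (mul_mem hd (sub_mem hd hc)) hmem, ?_⟩
  field_simp
  ring

lemma exists_pairedProd_eq (ht : t ∈ S) (hinv : ∀ d ∈ S, 1 - t * d ≠ 0 ∧ (1 - t * d)⁻¹ ∈ S)
    {b : ℤ → K} {w : K} {x : ℤ} {k : ℕ}
    (hx : ∀ i < k, b (3 * i + x) ≠ 0 ∧ w / b (3 * i + x) ^ 2 ∈ S)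
    (h3 : ∀ i < k, b (3 * i + 3) ≠ 0 ∧ w / b (3 * i + 3) ^ 2 ∈ S) :
    ∃ r ∈ S, pairedProd b (t * w) x k = ratioProd b x 3 k ^ 2 *
      (1 + t * w * pairedProdLogDeriv b x k + t ^ 2 * r) := by
  simp only [← Finset.mem_range] at hx h3
  obtain ⟨r, hr, h⟩ := exists_prod_one_add ht (s := Finset.range k)
    (fun i hi => sub_mem (h3 i hi).2 (hx i hi).2)
    (fun i hi => exists_one_sub_div_one_sub hinv (hx i hi).2 (h3 i hi).2)
  refine ⟨r, hr, ?_⟩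
  have logDeriv : t * w * pairedProdLogDeriv b x k =
      t * ∑ i ∈ Finset.range k, (w / b (3 * i + 3) ^ 2 - w / b (3 * i + x) ^ 2) := by
    simp only [pairedProdLogDeriv, Finset.mul_sum, mul_sub, mul_one_div, mul_div_assoc]
  rw [logDeriv, ← h, pairedProd, ratioProd, ratioProd, ← Finset.prod_pow, ← Finset.prod_mul_distrib]
  refine Finset.prod_congr rfl fun i hi => ?_
  have factor (u : K) (hu : u ≠ 0) : u ^ 2 - t * w = u ^ 2 * (1 - t * (w / u ^ 2)) := by
    field_simp
  rw [factor _ (hx i hi).1, factor _ (h3 i hi).1, mul_div_mul_comm, div_pow]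

end Expansion

section PadicInteger
variable {p : ℕ} [hp : Fact p.Prime]

lemma not_dvd_den_iff_mem_integer {r : ℚ} :
    ¬ p ∣ r.den ↔ r ∈ (Rat.padicValuation p).integer := by
  rw [Valuation.mem_integer_iff, Rat.padicValuation_le_one_iff]

lemma one_sub_inv_mem_integer {x : ℚ} (hx : Rat.padicValuation p x < 1) :
    1 - x ≠ 0 ∧ (1 - x)⁻¹ ∈ (Rat.padicValuation p).integer := by
  have h : Rat.padicValuation p (1 - x) = 1 := Valuation.map_one_sub_of_lt _ hx
  refine ⟨fun h0 => by simp [h0] at h, ?_⟩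
  rw [Valuation.mem_integer_iff, map_inv₀, h, inv_one]

lemma inv_intCast_mem_integer {b : ℤ} (hb : ¬ (p : ℤ) ∣ b) :
    (b : ℚ)⁻¹ ∈ (Rat.padicValuation p).integer := by
  rw [Valuation.mem_integer_iff, map_inv₀, Rat.padicValuation_cast,
    Int.padicValuation_eq_one_iff.2 hb, inv_one]

lemma pow_pred_div_mem_integer {s x : ℕ} (hx : 0 < x) (h : x < p ^ s) :
    (p : ℚ) ^ (s - 1) / x ∈ (Rat.padicValuation p).integer := by
  obtain ⟨v, y, hy, rfl⟩ := Nat.exists_eq_pow_mul_and_not_dvd hx.ne' p hp.out.ne_one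
  have hv : v < s := (Nat.pow_lt_pow_iff_right hp.out.one_lt).1
    ((Nat.le_mul_of_pos_right _ (Nat.pos_of_mul_pos_left hx)).trans_lt h)
  have hp0 : (p : ℚ) ≠ 0 := mod_cast hp.out.ne_zero
  obtain ⟨u, rfl⟩ : ∃ u, s = v + u + 1 := ⟨s - 1 - v, by omega⟩
  have : (p : ℚ) ^ (v + u + 1 - 1) / (p ^ v * y : ℕ) = p ^ u * ((y : ℤ) : ℚ)⁻¹ := by
    push_cast
    rw [pow_add]
    field_simp
  rw [this]
  exact mul_mem (pow_mem (natCast_mem _ p) u) (inv_intCast_mem_integer (mod_cast hy))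

lemma ascPochhammer_eval_div_factorial_mem_integer {x : ℚ}
    (hx : x ∈ (Rat.padicValuation p).integer) (n : ℕ) :
    (ascPochhammer ℚ n).eval x / n.factorial ∈ (Rat.padicValuation p).integer := by
  have hchoose : (ascPochhammer ℚ n).eval x / n.factorial = Ring.multichoose x n := by
    rw [div_eq_iff (mod_cast n.factorial_ne_zero), ← Polynomial.ascPochhammer_smeval_eq_eval,
      ← Ring.factorial_nsmul_multichoose_eq_ascPochhammer, nsmul_eq_mul, mul_comm]
  rw [Valuation.mem_integer_iff, ← Padic.norm_rat_le_one_iff_padicValuation_le_one] at hx ⊢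
  obtain ⟨z, hz⟩ : ∃ z : ℤ_[p], PadicInt.Coe.ringHom z = Rat.castHom ℚ_[p] x := ⟨⟨x, hx⟩, rfl⟩
  rw [hchoose, ← Rat.coe_castHom, Ring.map_multichoose, ← hz, ← Ring.map_multichoose]
  exact PadicInt.norm_le_one _

end PadicInteger

section Specialization
variable {R K F : Type*} [CommRing R] [Field K] [Field F]

/-- The pairs `(φ A / φ B, ε A / ε B)` with `B ∈ M`, that is, the fractions with denominator in
`M` together with their values under the evaluation `ε`. Both quotients are cleared, so that no
condition `φ B ≠ 0` or `ε B ≠ 0` is needed. -/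
def specialization (φ : R →+* K) (ε : R →+* F) (M : Submonoid R) : Subring (K × F) where
  carrier := {x | ∃ A, ∃ B ∈ M, x.1 * φ B = φ A ∧ x.2 * ε B = ε A}
  zero_mem' := ⟨0, 1, one_mem M, by simp⟩
  one_mem' := ⟨1, 1, one_mem M, by simp⟩
  add_mem' := by
    rintro _ _ ⟨A, B, hB, h₁, h₂⟩ ⟨C, D, hD, h₃, h₄⟩
    refine ⟨A * D + C * B, B * D, mul_mem hB hD, ?_, ?_⟩ <;>
      simp only [Prod.fst_add, Prod.snd_add, map_add, map_mul, ← h₁, ← h₂, ← h₃, ← h₄] <;> ring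
  mul_mem' := by
    rintro _ _ ⟨A, B, hB, h₁, h₂⟩ ⟨C, D, hD, h₃, h₄⟩
    refine ⟨A * C, B * D, mul_mem hB hD, ?_, ?_⟩ <;>
      simp only [Prod.fst_mul, Prod.snd_mul, map_mul, ← h₁, ← h₂, ← h₃, ← h₄] <;> ring
  neg_mem' := by
    rintro _ ⟨A, B, hB, h₁, h₂⟩
    exact ⟨-A, B, hB, by simp [h₁], by simp [h₂]⟩

lemma map_mem_specialization (φ : R →+* K) (ε : R →+* F) (M : Submonoid R) (A : R) :
    (φ A, ε A) ∈ specialization φ ε M :=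
  ⟨A, 1, one_mem M, by simp⟩

variable {S : Subring (K × F)}

lemma sum_pair_mem {ι : Type*} {s : Finset ι} {f : ι → K} {x : ι → F}
    (h : ∀ i ∈ s, (f i, x i) ∈ S) : (∑ i ∈ s, f i, ∑ i ∈ s, x i) ∈ S :=
  prod_mk_sum s f x ▸ sum_mem h

lemma prod_pair_mem {ι : Type*} {s : Finset ι} {f : ι → K} {x : ι → F}
    (h : ∀ i ∈ s, (f i, x i) ∈ S) : (∏ i ∈ s, f i, ∏ i ∈ s, x i) ∈ S :=
  prod_mk_prod s f x ▸ prod_mem h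

lemma ratioProd_pair_mem {b : ℤ → K} {β : ℤ → F} {x y : ℤ} {k : ℕ}
    (hx : ∀ i < k, (b (3 * i + x), β (3 * i + x)) ∈ S)
    (hy : ∀ i < k, ((b (3 * i + y))⁻¹, (β (3 * i + y))⁻¹) ∈ S) :
    (ratioProd b x y k, ratioProd β x y k) ∈ S := by
  simp only [ratioProd, div_eq_mul_inv]
  exact prod_pair_mem fun i hi =>
    mul_mem (hx i (Finset.mem_range.1 hi)) (hy i (Finset.mem_range.1 hi))

lemma diffTerm_pair_mem {b : ℤ → K} {c : ℤ} {k : ℕ} {z u v w : F} (hz : (b (6 * k + 1), z) ∈ S)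
    (hu : (ratioProd b 1 3 k, u) ∈ S) (hv : (ratioProd b (1 + c) (3 + c) k, v) ∈ S)
    (hw : (ratioProd b (1 - c) (3 - c) k, w) ∈ S) :
    (diffTerm b c k, z * u ^ 2 * (u ^ 2 - v * w) ^ 2) ∈ S :=
  mul_mem (mul_mem hz (pow_mem hu 2)) (pow_mem (sub_mem (pow_mem hu 2) (mul_mem hv hw)) 2)

end Specialization

/-- The symmetric `q`-analogue `(q ^ x - q ^ (-x)) / (q - q⁻¹)` of the integer `x`. -/
noncomputable def qNum {F : Type*} [Field F] (q : F) (x : ℤ) : F :=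
  (q ^ x - q ^ (-x)) / (q - q⁻¹)

section QNum
variable {F : Type*} [Field F] {q : F}

lemma qNum_neg (q : F) (x : ℤ) : qNum q (-x) = -qNum q x := by
  rw [qNum, qNum, neg_neg, ← neg_div, neg_sub]

@[simp]
lemma qNum_zero (q : F) : qNum q 0 = 0 := by simp [qNum]

lemma sub_inv_ne_zero (hq : q ≠ 0) (hq2 : q ^ 2 ≠ 1) : q - q⁻¹ ≠ 0 := by
  rwa [sub_ne_zero, Ne, ← mul_eq_one_iff_eq_inv₀ hq, ← sq]

lemma qNum_eq_zero_iff (hq : q ≠ 0) (hq2 : q ^ 2 ≠ 1) (x : ℤ) :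
    qNum q x = 0 ↔ q ^ (2 * x) = 1 := by
  rw [qNum, div_eq_zero_iff, or_iff_left (sub_inv_ne_zero hq hq2), sub_eq_zero, zpow_neg,
    ← mul_eq_one_iff_eq_inv₀ (zpow_ne_zero x hq), two_mul, zpow_add₀ hq]

lemma qNum_succ_mul_pow (hq : q ≠ 0) (hq2 : q ^ 2 ≠ 1) (n : ℕ) :
    qNum q (n + 1 : ℕ) * q ^ n = ∑ i ∈ Finset.range (n + 1), (q ^ 2) ^ i := by
  have hsub := sub_inv_ne_zero hq hq2
  rw [geom_sum_eq hq2, qNum, zpow_neg, zpow_natCast, div_mul_eq_mul_div,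
    div_eq_div_iff hsub (sub_ne_zero.2 hq2)]
  field_simp
  ring

lemma qNum_mul (hq : q ≠ 0) (x y : ℤ) (h : (q ^ x) ^ 2 ≠ 1) :
    qNum q (x * y) = qNum q x * qNum (q ^ x) y := by
  rw [qNum, qNum, qNum, zpow_neg q x, ← zpow_mul, ← zpow_mul, mul_neg, div_mul_div_comm,
    mul_comm (q - q⁻¹), mul_div_mul_left _ _ (sub_inv_ne_zero (zpow_ne_zero x hq) h)]

lemma qNum_add_mul_qNum_sub (hq : q ≠ 0) (x y : ℤ) :
    qNum q (x + y) * qNum q (x - y) = qNum q x ^ 2 - qNum q y ^ 2 := by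
  simp only [qNum, div_mul_div_comm, div_pow, ← sub_div, ← sq, zpow_neg, zpow_sub₀ hq,
    zpow_add₀ hq]
  congr 1
  field_simp [zpow_ne_zero x hq, zpow_ne_zero y hq]
  ring

variable (k : Type*) [Field k]

lemma ratFuncX_zpow_ne_one {x : ℤ} (hx : x ≠ 0) : (RatFunc.X : RatFunc k) ^ x ≠ 1 := by
  have pow_ne_one {m : ℕ} (hm : m ≠ 0) : (RatFunc.X : RatFunc k) ^ m ≠ 1 := by
    rw [← RatFunc.algebraMap_X, ← map_pow, ← map_one (algebraMap k[X] (RatFunc k)),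
      (RatFunc.algebraMap_injective k).ne_iff]
    exact fun h => hm (by simpa using congrArg natDegree h)
  obtain ⟨m, rfl | rfl⟩ := x.eq_nat_or_neg
  · exact mod_cast pow_ne_one (by omega)
  · rw [zpow_neg, Ne, inv_eq_one, zpow_natCast]
    exact pow_ne_one (by omega)

lemma ratFuncX_sq_ne_one : (RatFunc.X : RatFunc k) ^ 2 ≠ 1 :=
  mod_cast ratFuncX_zpow_ne_one k two_ne_zero

lemma qNum_X_eq_zero_iff (x : ℤ) : qNum (RatFunc.X : RatFunc k) x = 0 ↔ x = 0 := by
  refine ⟨fun h => ?_, fun h => h ▸ qNum_zero _⟩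
  rw [qNum_eq_zero_iff RatFunc.X_ne_zero (ratFuncX_sq_ne_one k)] at h
  by_contra hx
  exact ratFuncX_zpow_ne_one k (mul_ne_zero two_ne_zero hx) h

end QNum

section ValueAt
variable {k L : Type*} [Field k] [Field L] [Algebra k L]

/-- The pairs `(f, f(ζ))`, where `f` is a rational function over `k` that is regular at `ζ`. -/
noncomputable def valueAt (k : Type*) {L : Type*} [Field k] [Field L] [Algebra k L] (ζ : L) :
    Subring (RatFunc k × L) :=
  specialization (algebraMap k[X] (RatFunc k)) (aeval ζ : k[X] →ₐ[k] L).toRingHom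
    ((nonZeroDivisors L).comap (aeval ζ : k[X] →ₐ[k] L).toRingHom)

variable {ζ : L}

lemma X_mem_valueAt (ζ : L) : (RatFunc.X, ζ) ∈ valueAt k ζ := by
  have h := map_mem_specialization (algebraMap k[X] (RatFunc k))
    (aeval ζ : k[X] →ₐ[k] L).toRingHom
    ((nonZeroDivisors L).comap (aeval ζ : k[X] →ₐ[k] L).toRingHom) X
  rwa [RatFunc.algebraMap_X, AlgHom.toRingHom_eq_coe, RingHom.coe_coe, aeval_X] at h

lemma ne_zero_of_mem_valueAt {f : RatFunc k} {y : L} (hf : (f, y) ∈ valueAt k ζ) (hy : y ≠ 0) :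
    f ≠ 0 := by
  rintro rfl
  obtain ⟨A, B, hB, hfB, hyB⟩ := hf
  rw [zero_mul, eq_comm, map_eq_zero_iff _ (RatFunc.algebraMap_injective k)] at hfB
  rw [hfB, map_zero] at hyB
  exact mul_ne_zero hy (nonZeroDivisors.ne_zero hB) hyB

lemma inv_mem_valueAt {f : RatFunc k} {y : L} (hf : (f, y) ∈ valueAt k ζ) (hy : y ≠ 0) :
    (f⁻¹, y⁻¹) ∈ valueAt k ζ := by
  have hf0 := ne_zero_of_mem_valueAt hf hy
  obtain ⟨A, B, hB, hfB, hyB⟩ := hf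
  change y * aeval ζ B = aeval ζ A at hyB
  have hA : aeval ζ A ≠ 0 := hyB ▸ mul_ne_zero hy (nonZeroDivisors.ne_zero hB)
  exact ⟨B, A, mem_nonZeroDivisors_of_ne_zero hA, by simp [← hfB, hf0], by
    change y⁻¹ * aeval ζ A = aeval ζ B
    rw [← hyB, inv_mul_cancel_left₀ hy]⟩

lemma zpow_mem_valueAt {f : RatFunc k} {y : L} (hf : (f, y) ∈ valueAt k ζ) (hy : y ≠ 0) (n : ℤ) :
    (f ^ n, y ^ n) ∈ valueAt k ζ := by
  obtain ⟨m, rfl | rfl⟩ := n.eq_nat_or_neg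
  · simpa only [zpow_natCast] using! pow_mem hf m
  · simpa only [zpow_neg, zpow_natCast] using! inv_mem_valueAt (pow_mem hf m) (pow_ne_zero m hy)

lemma qNum_mem_valueAt (hζ : ζ ≠ 0) (hζ2 : ζ ^ 2 ≠ 1) (x : ℤ) :
    (qNum RatFunc.X x, qNum ζ x) ∈ valueAt k ζ := by
  have hX : (RatFunc.X, ζ) ∈ valueAt k ζ := X_mem_valueAt ζ
  rw [qNum, qNum, div_eq_mul_inv, div_eq_mul_inv]
  exact mul_mem (sub_mem (zpow_mem_valueAt hX hζ x) (zpow_mem_valueAt hX hζ (-x)))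
    (inv_mem_valueAt (sub_mem hX (inv_mem_valueAt hX hζ)) (sub_inv_ne_zero hζ hζ2))

lemma qNum_mem_valueAt_of_one {f : RatFunc k} (hf : (f, (1 : L)) ∈ valueAt k ζ) (hf0 : f ≠ 0)
    (hf2 : f ^ 2 ≠ 1) (x : ℤ) : (qNum f x, (x : L)) ∈ valueAt k ζ := by
  have natCast_mem (n : ℕ) : (qNum f n, (n : L)) ∈ valueAt k ζ := by
    rcases n with _ | n
    · rw [Nat.cast_zero, Nat.cast_zero, qNum_zero]
      exact zero_mem _
    have h := mul_mem (sum_pair_mem (s := Finset.range (n + 1)) fun i _ => pow_mem (pow_mem hf 2) i)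
      (inv_mem_valueAt (pow_mem hf n) (pow_ne_zero n one_ne_zero))
    change ((∑ i ∈ Finset.range (n + 1), (f ^ 2) ^ i) * (f ^ n)⁻¹,
      (∑ i ∈ Finset.range (n + 1), ((1 : L) ^ 2) ^ i) * (1 ^ n)⁻¹) ∈ valueAt k ζ at h
    rw [← qNum_succ_mul_pow hf0 hf2, mul_inv_cancel_right₀ (pow_ne_zero n hf0)] at h
    simpa using h
  obtain ⟨m, rfl | rfl⟩ := x.eq_nat_or_neg
  · simpa using natCast_mem m
  · simpa [qNum_neg] using neg_mem (natCast_mem m)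

lemma exists_qNum_div_qNum_mem_valueAt [CharZero L] {P : ℕ} (hP : P ≠ 0) (hζ : ζ ^ P = 1)
    {x y : ℤ} (hx : (P : ℤ) ∣ x) (hy : (P : ℤ) ∣ y) (hy0 : y ≠ 0) :
    ∃ c, (qNum RatFunc.X x / qNum RatFunc.X y, c) ∈ valueAt k ζ := by
  obtain ⟨x, rfl⟩ := hx
  obtain ⟨y, rfl⟩ := hy
  have hX : (RatFunc.X ^ (P : ℤ), (1 : L)) ∈ valueAt k ζ := by
    simpa [hζ] using! pow_mem (X_mem_valueAt (k := k) ζ) P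
  have hX0 : (RatFunc.X ^ (P : ℤ) : RatFunc k) ≠ 0 := zpow_ne_zero _ RatFunc.X_ne_zero
  have hX2 : ((RatFunc.X : RatFunc k) ^ (P : ℤ)) ^ 2 ≠ 1 := by
    rw [← zpow_natCast, ← zpow_mul]
    exact ratFuncX_zpow_ne_one k (by positivity)
  have hP0 : qNum (RatFunc.X : RatFunc k) P ≠ 0 := by
    rw [Ne, qNum_X_eq_zero_iff]
    exact_mod_cast hP
  have hy1 : (y : L) ≠ 0 := Int.cast_ne_zero.2 (right_ne_zero_of_mul hy0)
  refine ⟨x * (y : L)⁻¹, ?_⟩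
  rw [qNum_mul RatFunc.X_ne_zero _ _ hX2, qNum_mul RatFunc.X_ne_zero _ _ hX2,
    mul_div_mul_left _ _ hP0, div_eq_mul_inv]
  exact mul_mem (qNum_mem_valueAt_of_one hX hX0 hX2 x)
    (inv_mem_valueAt (qNum_mem_valueAt_of_one hX hX0 hX2 y) hy1)

end ValueAt

section Reflection
variable {F : Type*} [Field F] {P n : ℕ}

/-- `β` is an odd function on `ℤ` with period `P` that vanishes exactly on the multiples of `P`;
such are the `q`-numbers at a primitive `P`-th root of unity, for odd `P`. -/
structure IsOddPeriodic (β : ℤ → F) (P : ℕ) : Prop where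
  neg : ∀ x, β (-x) = -β x
  add : ∀ x y, (P : ℤ) ∣ y → β (x + y) = β x
  eq_zero_iff : ∀ x, β x = 0 ↔ (P : ℤ) ∣ x

lemma not_dvd_three_mul_add_three (h3 : Nat.Coprime P 3) {i : ℕ} (hi : i + 1 < P) :
    ¬ (P : ℤ) ∣ 3 * i + 3 := by
  intro h
  have h : P ∣ 3 * (i + 1) := by exact_mod_cast h
  have := Nat.le_of_dvd (by omega) (h3.dvd_of_dvd_mul_left h)
  omega

lemma not_dvd_three_mul_add_three_add (h3 : Nat.Coprime P 3) {c : ℤ} (hc : (P : ℤ) ∣ c) {i : ℕ}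
    (hi : i + 1 < P) : ¬ (P : ℤ) ∣ 3 * i + (3 + c) := by
  rw [← add_assoc, dvd_add_left hc]
  exact not_dvd_three_mul_add_three h3 hi

lemma coprime_three_of_dvd (hn : P ∣ 3 * n + 1) : Nat.Coprime P 3 :=
  Nat.Coprime.coprime_dvd_left hn (by simp)

lemma not_dvd_three_mul_add_one (hn : P ∣ 3 * n + 1) (hnP : n < P) {i : ℕ} (hi : i < n) :
    ¬ (P : ℤ) ∣ 3 * i + 1 := by
  intro h
  have h : P ∣ 3 * i + 1 := by exact_mod_cast h
  have hsub : P ∣ 3 * (n - i) := by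
    convert Nat.dvd_sub hn h using 1
    omega
  have := Nat.le_of_dvd (by omega) ((coprime_three_of_dvd hn).dvd_of_dvd_mul_left hsub)
  omega

namespace IsOddPeriodic
variable {β : ℤ → F} (hβ : IsOddPeriodic β P)
include hβ

lemma ratioProd_eq_zero (hn : P ∣ 3 * n + 1) {k : ℕ} (hk : n < k) : ratioProd β 1 3 k = 0 :=
  _root_.ratioProd_eq_zero ((hβ.eq_zero_iff _).2 (mod_cast hn)) hk

lemma ratioProd_add_add {x y c : ℤ} (hc : (P : ℤ) ∣ c) (k : ℕ) :
    ratioProd β (x + c) (y + c) k = ratioProd β x y k := by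
  simp only [ratioProd, ← add_assoc, hβ.add _ c hc]

lemma reflect (hn : P ∣ 3 * n + 1) {x y : ℤ} (h : x + y = 3 * n + 1) : β x = -β y := by
  rw [← hβ.neg, ← hβ.add (-y) (3 * n + 1) (mod_cast hn), ← h, neg_add_eq_sub, add_sub_cancel_right]

lemma three_mul_add_three_ne_zero (h3 : Nat.Coprime P 3) {i : ℕ} (hi : i + 1 < P) :
    β (3 * i + 3) ≠ 0 := by
  rw [Ne, hβ.eq_zero_iff]
  exact not_dvd_three_mul_add_three h3 hi

lemma three_mul_add_one_ne_zero (hn : P ∣ 3 * n + 1) (hnP : n < P) {i : ℕ}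
    (hi : i < n) : β (3 * i + 1) ≠ 0 := by
  rw [Ne, hβ.eq_zero_iff]
  exact not_dvd_three_mul_add_one hn hnP hi

lemma ratioProd_reflect (hn : P ∣ 3 * n + 1) (hnP : n < P) {k : ℕ}
    (hk : k ≤ n) : ratioProd β 1 3 (n - k) = ratioProd β 1 3 n * ratioProd β 1 3 k := by
  induction k with
  | zero => simp
  | succ k ih =>
    obtain ⟨m, rfl⟩ := Nat.exists_eq_add_of_le hk
    have hone := hβ.three_mul_add_one_ne_zero hn hnP (i := k) (by omega)
    have hthree := hβ.three_mul_add_three_ne_zero (coprime_three_of_dvd hn) (i := k) (by omega)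
    have h := ih (by omega)
    rw [show k + 1 + m - k = m + 1 by omega, ratioProd_succ,
      hβ.reflect hn (x := 3 * m + 1) (y := 3 * k + 3) (by push_cast; ring),
      hβ.reflect hn (x := 3 * m + 3) (y := 3 * k + 1) (by push_cast; ring), neg_div_neg_eq] at h
    rw [Nat.add_sub_cancel_left, ratioProd_succ, ← mul_assoc, ← h, mul_assoc,
      div_mul_div_cancel₀ hone, div_self hthree, mul_one]

lemma ratioProd_pow_six_reflect (hn : P ∣ 3 * n + 1) (hnP : n < P) {k : ℕ} (hk : k ≤ n) :
    ratioProd β 1 3 (n - k) ^ 6 = ratioProd β 1 3 k ^ 6 := by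
  have h : ratioProd β 1 3 n ^ 2 = 1 := by
    simpa [sq] using (hβ.ratioProd_reflect hn hnP le_rfl).symm
  rw [hβ.ratioProd_reflect hn hnP hk, mul_pow, pow_mul _ 2 3, h, one_pow, one_mul]

lemma pairedProdLogDeriv_reflect (h2 : (2 : F) ≠ 0) (hn : P ∣ 3 * n + 1) {k : ℕ} (hk : k ≤ n) :
    pairedProdLogDeriv β 1 (n - k) = pairedProdLogDeriv β 1 k := by
  have additive (k : ℕ) (hk : k ≤ n) :
      pairedProdLogDeriv β 1 (n - k) = pairedProdLogDeriv β 1 n + pairedProdLogDeriv β 1 k := by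
    induction k with
    | zero => simp [pairedProdLogDeriv]
    | succ k ih =>
      obtain ⟨m, rfl⟩ := Nat.exists_eq_add_of_le hk
      have ih := ih (by omega)
      rw [show k + 1 + m - k = m + 1 by omega, pairedProdLogDeriv_succ,
        hβ.reflect hn (x := 3 * m + 1) (y := 3 * k + 3) (by push_cast; ring),
        hβ.reflect hn (x := 3 * m + 3) (y := 3 * k + 1) (by push_cast; ring), neg_sq, neg_sq] at ih
      rw [Nat.add_sub_cancel_left, pairedProdLogDeriv_succ]
      linear_combination ih
  have total : pairedProdLogDeriv β 1 n = 0 := by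
    have h := additive n le_rfl
    rwa [Nat.sub_self, ← two_mul, show pairedProdLogDeriv β 1 0 = 0 from Finset.sum_range_zero _,
      eq_comm, mul_eq_zero, or_iff_right h2] at h
  rw [additive k hk, total, zero_add]

lemma sum_mul_eq_zero (h2 : (2 : F) ≠ 0) (hn : P ∣ 3 * n + 1) {g : ℕ → F}
    (hg : ∀ k ≤ n, g (n - k) = g k) (hg0 : ∀ k, n < k → g k = 0) {l : ℕ} (hl : n < l) :
    ∑ k ∈ Finset.range l, β (6 * k + 1) * g k = 0 := by
  have antisymm (k : ℕ) (hk : k ∈ Finset.range (n + 1)) :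
      β (6 * (n + 1 - 1 - k : ℕ) + 1) * g (n + 1 - 1 - k) = -(β (6 * k + 1) * g k) := by
    have hk := Finset.mem_range_succ_iff.1 hk
    rw [Nat.add_sub_cancel, hg k hk, ← neg_mul, ← hβ.neg,
      ← hβ.add (-(6 * (k : ℤ) + 1)) (2 * (3 * n + 1)) (Dvd.dvd.mul_left (mod_cast hn) _)]
    congr 2
    push_cast [hk]
    ring
  have h := Finset.sum_range_reflect (fun k : ℕ => β (6 * k + 1) * g k) (n + 1)
  rw [Finset.sum_congr rfl antisymm, Finset.sum_neg_distrib, eq_comm, eq_neg_iff_add_eq_zero,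
    ← two_mul, mul_eq_zero, or_iff_right h2] at h
  rw [← h, eq_comm]
  refine Finset.sum_subset (Finset.range_mono hl) fun k _ hk => ?_
  rw [hg0 k (by simpa using hk), mul_zero]

lemma sum_ratioProd_pow_six_eq_zero (h2 : (2 : F) ≠ 0) (hn : P ∣ 3 * n + 1) (hnP : n < P) {l : ℕ}
    (hl : n < l) : ∑ k ∈ Finset.range l, β (6 * k + 1) * ratioProd β 1 3 k ^ 6 = 0 :=
  hβ.sum_mul_eq_zero h2 hn
    (fun _ hk => hβ.ratioProd_pow_six_reflect hn hnP hk)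
    (fun k hk => by rw [hβ.ratioProd_eq_zero hn hk, zero_pow (by norm_num)]) hl

end IsOddPeriodic

lemma sq_ne_one_of_isPrimitiveRoot {ζ : F} (hP : 1 < P) (hodd : Odd P) (hζ : IsPrimitiveRoot ζ P) :
    ζ ^ 2 ≠ 1 := by
  intro h
  have hdvd := (Nat.dvd_prime Nat.prime_two).1 (hζ.dvd_of_pow_eq_one 2 h)
  obtain ⟨k, rfl⟩ := hodd
  omega

lemma isOddPeriodic_qNum {ζ : F} (hP : 1 < P) (hodd : Odd P) (hζ : IsPrimitiveRoot ζ P) :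
    IsOddPeriodic (qNum ζ) P where
  neg := qNum_neg ζ
  add x y hy := by
    have hζ0 : ζ ≠ 0 := hζ.ne_zero (by omega)
    rw [qNum, qNum, neg_add, zpow_add₀ hζ0, zpow_add₀ hζ0, zpow_neg ζ y,
      (hζ.zpow_eq_one_iff_dvd y).2 hy, inv_one, mul_one, mul_one]
  eq_zero_iff x := by
    rw [qNum_eq_zero_iff (hζ.ne_zero (by omega)) (sq_ne_one_of_isPrimitiveRoot hP hodd hζ),
      hζ.zpow_eq_one_iff_dvd]
    exact ⟨(Nat.isCoprime_iff_coprime.2 (Nat.coprime_two_right.2 hodd)).dvd_of_dvd_mul_left,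
      fun h => h.mul_left 2⟩

end Reflection

section Blocks
variable {k L : Type*} [Field k] [Field L] [Algebra k L] {P n : ℕ} {ζ : L}
  (hP : 1 < P) (hodd : Odd P) (hζ : IsPrimitiveRoot ζ P)
include hP hodd hζ

lemma qNum_mem_valueAt_of_isPrimitiveRoot (x : ℤ) :
    (qNum RatFunc.X x, qNum ζ x) ∈ valueAt k ζ :=
  qNum_mem_valueAt (hζ.ne_zero (by omega)) (sq_ne_one_of_isPrimitiveRoot hP hodd hζ) x

lemma inv_qNum_mem_valueAt {x : ℤ} (hx : ¬ (P : ℤ) ∣ x) :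
    ((qNum RatFunc.X x)⁻¹, (qNum ζ x)⁻¹) ∈ valueAt k ζ :=
  inv_mem_valueAt (qNum_mem_valueAt_of_isPrimitiveRoot hP hodd hζ x)
    (mt ((isOddPeriodic_qNum hP hodd hζ).eq_zero_iff x).1 hx)

lemma ratioProd_mem_valueAt (h3 : Nat.Coprime P 3) {c : ℤ} (hc : (P : ℤ) ∣ c) {r : ℕ}
    (hr : r < P) :
    (ratioProd (qNum RatFunc.X) (1 + c) (3 + c) r, ratioProd (qNum ζ) 1 3 r) ∈ valueAt k ζ := by
  rw [← (isOddPeriodic_qNum hP hodd hζ).ratioProd_add_add hc r]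
  exact ratioProd_pair_mem (fun i _ => qNum_mem_valueAt_of_isPrimitiveRoot hP hodd hζ _)
    fun i hi => inv_qNum_mem_valueAt hP hodd hζ
      (not_dvd_three_mul_add_three_add h3 hc (by omega))

lemma exists_prod_mul_prod_inv_mem_valueAt (h3 : Nat.Coprime P 3) {c : ℤ} (hc : (P : ℤ) ∣ c)
    (s : Finset ℕ) {r : ℕ} (hr : r < P) :
    ∃ y, ((∏ i ∈ s, qNum RatFunc.X (3 * i + (1 + c))) *
      ∏ i ∈ Finset.range r, (qNum RatFunc.X (3 * i + (3 + c)))⁻¹, y) ∈ valueAt k ζ :=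
  ⟨_, mul_mem
    (prod_pair_mem fun i _ =>
      qNum_mem_valueAt_of_isPrimitiveRoot hP hodd hζ (3 * (i : ℕ) + (1 + c)))
    (prod_pair_mem fun i (hi : i ∈ Finset.range r) => inv_qNum_mem_valueAt hP hodd hζ
      (not_dvd_three_mul_add_three_add h3 hc (by have := Finset.mem_range.1 hi; omega)))⟩

variable [CharZero L] (hn : P ∣ 3 * n + 1) (hnP : n < P)
include hn hnP

-- The zero of the numerator at `i = n` cancels that of the denominator at `i = P - 1`.
lemma exists_ratioProd_block_mem_valueAt {c : ℤ} (hc : (P : ℤ) ∣ c) (hc0 : 3 * P + c ≠ 0) :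
    ∃ y, (ratioProd (qNum RatFunc.X) (1 + c) (3 + c) P, y) ∈ valueAt k ζ := by
  obtain ⟨Q, rfl⟩ : ∃ Q, P = Q + 1 := ⟨P - 1, by omega⟩
  have hlast : 3 * (Q : ℤ) + (3 + c) = 3 * (Q + 1 : ℕ) + c := by push_cast; ring
  obtain ⟨z, hz⟩ := exists_qNum_div_qNum_mem_valueAt (k := k) (by omega) hζ.pow_eq_one
    (x := 3 * n + (1 + c)) (y := 3 * Q + (3 + c))
    (by rw [← add_assoc]; exact dvd_add (mod_cast hn) hc)
    (by rw [hlast]; exact dvd_add (Dvd.intro_left _ rfl) hc) (by rwa [hlast])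
  rw [ratioProd_succ_eq_mul_prod_erase _ _ _ (Nat.lt_succ_iff.1 hnP)]
  obtain ⟨y, hy⟩ := exists_prod_mul_prod_inv_mem_valueAt (k := k) hP hodd hζ
    (coprime_three_of_dvd hn) hc ((Finset.range (Q + 1)).erase n) Q.lt_succ_self
  exact ⟨_, mul_mem hz hy⟩

lemma exists_ratioProd_mul_mem_valueAt {c : ℤ} (hc : (P : ℤ) ∣ c)
    (hc0 : ∀ i : ℕ, 3 * (i + 1) + c ≠ 0) (a : ℕ) :
    ∃ y, ∀ r < P, (ratioProd (qNum RatFunc.X) (1 + c) (3 + c) (a * P + r),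
      y * ratioProd (qNum ζ) 1 3 r) ∈ valueAt k ζ := by
  have hshift (a : ℕ) : (P : ℤ) ∣ c + 3 * (a * P : ℕ) :=
    dvd_add hc (Dvd.dvd.mul_left (mod_cast Dvd.intro_left a rfl) 3)
  suffices ∃ y, (ratioProd (qNum RatFunc.X) (1 + c) (3 + c) (a * P), y) ∈ valueAt k ζ by
    obtain ⟨y, hy⟩ := this
    refine ⟨y, fun r hr => ?_⟩
    rw [ratioProd_add, add_assoc, add_assoc]
    exact mul_mem hy
      (ratioProd_mem_valueAt hP hodd hζ (coprime_three_of_dvd hn) (hshift a) hr)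
  induction a with
  | zero => exact ⟨1, by rw [zero_mul]; exact one_mem _⟩
  | succ a ih =>
    obtain ⟨y, hy⟩ := ih
    have hne : 3 * (P : ℤ) + (c + 3 * (a * P : ℕ)) ≠ 0 := by
      convert hc0 ((a + 1) * P - 1) using 1
      rw [Nat.cast_sub (by nlinarith)]
      push_cast
      ring
    obtain ⟨z, hz⟩ := exists_ratioProd_block_mem_valueAt (k := k) hP hodd hζ hn hnP (hshift a) hne
    rw [add_one_mul, ratioProd_add, add_assoc, add_assoc]
    exact ⟨y * z, mul_mem hy hz⟩

variable {N : ℤ} (hN : (P : ℤ) ∣ N) (hN3 : ¬ (3 : ℤ) ∣ N)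
include hN hN3

lemma exists_diffTerm_mem_valueAt (a : ℕ) :
    ∃ C, ∀ r < P, (diffTerm (qNum RatFunc.X) N (a * P + r),
      C * (qNum ζ (6 * r + 1) * ratioProd (qNum ζ) 1 3 r ^ 6)) ∈ valueAt k ζ := by
  obtain ⟨y, hy⟩ := exists_ratioProd_mul_mem_valueAt (k := k) hP hodd hζ hn hnP (dvd_zero _)
    (fun i => by omega) a
  obtain ⟨z, hz⟩ := exists_ratioProd_mul_mem_valueAt (k := k) hP hodd hζ hn hnP hN
    (fun i h => hN3 (by omega)) a
  obtain ⟨w, hw⟩ := exists_ratioProd_mul_mem_valueAt (k := k) hP hodd hζ hn hnP (dvd_neg.2 hN)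
    (fun i h => hN3 (by omega)) a
  refine ⟨y ^ 2 * (y ^ 2 - z * w) ^ 2, fun r hr => ?_⟩
  have periodic : qNum ζ (6 * (a * P + r : ℕ) + 1) = qNum ζ (6 * r + 1) := by
    rw [← (isOddPeriodic_qNum hP hodd hζ).add (6 * r + 1) (6 * a * P) (Dvd.intro_left _ rfl)]
    congr 1
    push_cast
    ring
  have h := diffTerm_pair_mem (qNum_mem_valueAt_of_isPrimitiveRoot hP hodd hζ _)
    (hy r hr) (hz r hr) (hw r hr)
  rw [periodic] at h
  convert! h using 2
  ring

lemma sum_diffTerm_block_mem_valueAt (a : ℕ) {l : ℕ} (hl : n < l) (hlP : l ≤ P) :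
    (∑ r ∈ Finset.range l, diffTerm (qNum RatFunc.X) N (a * P + r), (0 : L)) ∈ valueAt k ζ := by
  obtain ⟨C, hC⟩ := exists_diffTerm_mem_valueAt (k := k) hP hodd hζ hn hnP hN hN3 a
  have h := sum_pair_mem fun r hr => hC r ((Finset.mem_range.1 hr).trans_le hlP)
  rwa [← Finset.mul_sum, (isOddPeriodic_qNum hP hodd hζ).sum_ratioProd_pow_six_eq_zero two_ne_zero
    hn hnP hl, mul_zero] at h

lemma sum_diffTerm_mem_valueAt (a : ℕ) {l : ℕ} (hl : n < l) (hlP : l ≤ P) :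
    (∑ k ∈ Finset.range (a * P + l), diffTerm (qNum RatFunc.X) N k, (0 : L)) ∈ valueAt k ζ := by
  have blocks : (∑ k ∈ Finset.range (a * P), diffTerm (qNum RatFunc.X) N k, (0 : L)) ∈
      valueAt k ζ := by
    induction a with
    | zero => rw [zero_mul]; exact zero_mem _
    | succ a ih =>
      rw [add_one_mul, Finset.sum_range_add, ← add_zero (0 : L)]
      exact add_mem ih (sum_diffTerm_block_mem_valueAt hP hodd hζ hn hnP hN hN3 a hnP le_rfl)
  rw [Finset.sum_range_add, ← add_zero (0 : L)]
  exact add_mem blocks (sum_diffTerm_block_mem_valueAt hP hodd hζ hn hnP hN hN3 a hl hlP)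

end Blocks

section OrderFive
variable {k L : Type*} [Field k] [Field L] [Algebra k L] {ζ : L}

lemma inv_one_sub_mul_mem_valueAt {t d : RatFunc k} {y : L} (ht : (t, (0 : L)) ∈ valueAt k ζ)
    (hd : (d, y) ∈ valueAt k ζ) : 1 - t * d ≠ 0 ∧ ((1 - t * d)⁻¹, (1 : L)) ∈ valueAt k ζ := by
  have h : (1 - t * d, 1 - 0 * y) ∈ valueAt k ζ := sub_mem (one_mem _) (mul_mem ht hd)
  rw [zero_mul, sub_zero] at h
  exact ⟨ne_zero_of_mem_valueAt h one_ne_zero, inv_one (G := L) ▸ inv_mem_valueAt h one_ne_zero⟩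

lemma exists_pairedProd_eq_of_mem_valueAt {t : RatFunc k} (ht : (t, (0 : L)) ∈ valueAt k ζ)
    {b : ℤ → RatFunc k} {β : ℤ → L} {x : ℤ} {l : ℕ}
    (hx : ∀ i < l, (b (3 * i + x), β (3 * i + x)) ∈ valueAt k ζ ∧ β (3 * i + x) ≠ 0)
    (h3 : ∀ i < l, (b (3 * i + 3), β (3 * i + 3)) ∈ valueAt k ζ ∧ β (3 * i + 3) ≠ 0) :
    ∃ d, (d, pairedProdLogDeriv β x l) ∈ valueAt k ζ ∧
      pairedProd b t x l = ratioProd b x 3 l ^ 2 * (1 + t * d) := by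
  have inv_sq {f : RatFunc k} {y : L} (h : (f, y) ∈ valueAt k ζ ∧ y ≠ 0) :
      (1 / f ^ 2, 1 / y ^ 2) ∈ valueAt k ζ := by
    rw [one_div, one_div]
    exact inv_mem_valueAt (pow_mem h.1 2) (pow_ne_zero 2 h.2)
  obtain ⟨_, ⟨⟨r, y⟩, hr, rfl⟩, h⟩ := exists_pairedProd_eq
    (S := (valueAt k ζ).map (RingHom.fst (RatFunc k) L)) (t := t) (w := 1) ⟨_, ht, rfl⟩
    (by
      rintro _ ⟨⟨d, y⟩, hd, rfl⟩
      obtain ⟨hne, hmem⟩ := inv_one_sub_mul_mem_valueAt ht hd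
      exact ⟨hne, _, hmem, rfl⟩)
    (fun i hi => ⟨ne_zero_of_mem_valueAt (hx i hi).1 (hx i hi).2, _, inv_sq (hx i hi), rfl⟩)
    (fun i hi => ⟨ne_zero_of_mem_valueAt (h3 i hi).1 (h3 i hi).2, _, inv_sq (h3 i hi), rfl⟩)
  refine ⟨pairedProdLogDeriv b x l + t * r, ?_, ?_⟩
  · rw [← add_zero (pairedProdLogDeriv β x l), ← zero_mul y]
    exact add_mem (sum_pair_mem fun i hi => sub_mem (inv_sq (h3 i (Finset.mem_range.1 hi)))
      (inv_sq (hx i (Finset.mem_range.1 hi)))) (mul_mem ht hr)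
  · rw [mul_one] at h
    rw [h, RingHom.coe_fst]
    ring

variable {n : ℕ} (hn : 0 < n) (hodd : Odd (3 * n + 1)) (hζ : IsPrimitiveRoot ζ (3 * n + 1))
include hn hodd hζ

lemma qNum_three_mul_add_one_mem_valueAt :
    (qNum RatFunc.X (3 * n + 1), (0 : L)) ∈ valueAt k ζ := by
  have hP : 1 < 3 * n + 1 := by omega
  rw [← ((isOddPeriodic_qNum hP hodd hζ).eq_zero_iff (3 * n + 1)).2 (by push_cast; rfl)]
  exact qNum_mem_valueAt_of_isPrimitiveRoot hP hodd hζ _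

lemma exists_diffTerm_eq_of_le {l : ℕ} (hl : l ≤ n) :
    ∃ G, diffTerm (qNum RatFunc.X) (3 * n + 1) l = qNum RatFunc.X (3 * n + 1) ^ 4 * G ∧
      (G, qNum ζ (6 * l + 1) * (ratioProd (qNum ζ) 1 3 l ^ 6 *
        pairedProdLogDeriv (qNum ζ) 1 l ^ 2)) ∈ valueAt k ζ := by
  have hP : 1 < 3 * n + 1 := by omega
  have hβ := isOddPeriodic_qNum hP hodd hζ
  have regular := qNum_mem_valueAt_of_isPrimitiveRoot (k := k) hP hodd hζ
  have ht : (qNum RatFunc.X (3 * n + 1) ^ 2, (0 : L)) ∈ valueAt k ζ :=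
    zero_pow (M₀ := L) two_ne_zero ▸ pow_mem (qNum_three_mul_add_one_mem_valueAt hn hodd hζ) 2
  obtain ⟨d, hd, h⟩ := exists_pairedProd_eq_of_mem_valueAt ht (b := qNum RatFunc.X) (β := qNum ζ)
    (x := 1) (l := l)
    (fun i hi => ⟨regular _, hβ.three_mul_add_one_ne_zero dvd_rfl (by omega) (by omega)⟩)
    (fun i hi => ⟨regular _, hβ.three_mul_add_three_ne_zero (by simp) (by omega)⟩)
  have hR : (ratioProd (qNum RatFunc.X) 1 3 l, ratioProd (qNum ζ) 1 3 l) ∈ valueAt k ζ :=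
    ratioProd_mem_valueAt hP hodd hζ (by simp) (dvd_zero _) (by omega)
  refine ⟨qNum RatFunc.X (6 * l + 1) * (ratioProd (qNum RatFunc.X) 1 3 l ^ 6 * d ^ 2), ?_,
    mul_mem (regular _) (mul_mem (pow_mem hR 6) (pow_mem hd 2))⟩
  rw [diffTerm, ratioProd_mul_ratioProd (qNum_add_mul_qNum_sub RatFunc.X_ne_zero), h]
  ring

lemma exists_ratioProd_eq_mul {l : ℕ} (hl : n < l) (hl' : l < 3 * n + 1) :
    ∃ V v, ratioProd (qNum RatFunc.X) 1 3 l = qNum RatFunc.X (3 * n + 1) * V ∧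
      (V, v) ∈ valueAt k ζ := by
  have hP : 1 < 3 * n + 1 := by omega
  obtain ⟨l, rfl⟩ : ∃ m, l = m + 1 := ⟨l - 1, by omega⟩
  obtain ⟨y, hy⟩ := exists_prod_mul_prod_inv_mem_valueAt (k := k) hP hodd hζ (by simp) (dvd_zero _)
    ((Finset.range (l + 1)).erase n) (by omega : l < 3 * n + 1)
  refine ⟨_, _, ?_, mul_mem (inv_qNum_mem_valueAt hP hodd hζ
    (not_dvd_three_mul_add_three (by simp) hl')) hy⟩
  rw [ratioProd_succ_eq_mul_prod_erase _ _ _ (Nat.lt_succ_iff.1 hl), div_eq_mul_inv, mul_assoc]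
  rfl

lemma exists_diffTerm_eq_of_lt {l : ℕ} (hl : n < l) (hl' : l < 3 * n + 1) :
    ∃ G, diffTerm (qNum RatFunc.X) (3 * n + 1) l = qNum RatFunc.X (3 * n + 1) ^ 4 * G ∧
      (G, (0 : L)) ∈ valueAt k ζ := by
  have hP : 1 < 3 * n + 1 := by omega
  obtain ⟨V, v, hV, hv⟩ := exists_ratioProd_eq_mul (k := k) hn hodd hζ hl hl'
  have hzero : 3 * (n : ℤ) + (1 - (3 * n + 1)) = 0 := by ring
  have vanish : ratioProd (qNum (RatFunc.X : RatFunc k)) (1 - (3 * n + 1)) (3 - (3 * n + 1)) l =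
      0 := ratioProd_eq_zero (n := n) (by rw [hzero, qNum_zero]) hl
  have hN := qNum_three_mul_add_one_mem_valueAt (k := k) hn hodd hζ
  refine ⟨qNum RatFunc.X (6 * l + 1) * (V ^ 6 * qNum RatFunc.X (3 * n + 1) ^ 2), ?_, ?_⟩
  · rw [diffTerm, vanish, hV]
    ring
  · have h := mul_mem (qNum_mem_valueAt_of_isPrimitiveRoot hP hodd hζ (6 * l + 1))
      (mul_mem (pow_mem hv 6) (pow_mem hN 2))
    convert! h using 2
    simp

theorem exists_sum_diffTerm_eq [CharZero L] {m : ℕ} (hnm : n ≤ m) (hm : m < 3 * n + 1) :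
    ∃ G, ∑ l ∈ Finset.range (m + 1), diffTerm (qNum RatFunc.X) (3 * n + 1) l =
      qNum RatFunc.X (3 * n + 1) ^ 4 * G ∧ (G, (0 : L)) ∈ valueAt k ζ := by
  have hP : 1 < 3 * n + 1 := by omega
  have hβ := isOddPeriodic_qNum hP hodd hζ
  have term (l : ℕ) (hl : l ∈ Finset.range (m + 1)) :
      ∃ G, diffTerm (qNum RatFunc.X) (3 * n + 1) l = qNum RatFunc.X (3 * n + 1) ^ 4 * G ∧
        (G, qNum ζ (6 * l + 1) * (ratioProd (qNum ζ) 1 3 l ^ 6 *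
          pairedProdLogDeriv (qNum ζ) 1 l ^ 2)) ∈ valueAt k ζ := by
    rcases le_or_gt l n with hln | hln
    · exact exists_diffTerm_eq_of_le hn hodd hζ hln
    · rw [hβ.ratioProd_eq_zero dvd_rfl hln, zero_pow (by norm_num), zero_mul, mul_zero]
      exact exists_diffTerm_eq_of_lt hn hodd hζ hln ((Finset.mem_range_succ_iff.1 hl).trans_lt hm)
  choose! G hG hmem using term
  refine ⟨∑ l ∈ Finset.range (m + 1), G l, ?_, ?_⟩
  · rw [Finset.mul_sum]
    exact Finset.sum_congr rfl hG
  · have h := sum_pair_mem hmem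
    rwa [hβ.sum_mul_eq_zero two_ne_zero dvd_rfl
      (g := fun l => ratioProd (qNum ζ) 1 3 l ^ 6 * pairedProdLogDeriv (qNum ζ) 1 l ^ 2)
      (fun l hl => by
        rw [hβ.ratioProd_pow_six_reflect dvd_rfl (by omega) hl,
          hβ.pairedProdLogDeriv_reflect two_ne_zero dvd_rfl hl])
      (fun l hl => by rw [hβ.ratioProd_eq_zero dvd_rfl hl, zero_pow (by norm_num), zero_mul])
      (Nat.lt_succ_of_le hnm)] at h

end OrderFive

section VanishesToOrder
variable {R K : Type*} [CommRing R] [Field K] [Algebra R K]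

/-- `f` is a fraction over `R` divisible by `π ^ e` in the local ring at `π`: a lower bound `e` on
the order of vanishing of `f` along `π`. -/
def VanishesToOrder (π : R) (f : K) (e : ℕ) : Prop :=
  ∃ A B : R, ¬ π ∣ B ∧ f * algebraMap R K B = algebraMap R K (π ^ e * A)

namespace VanishesToOrder
variable {π : R} {f g : K} {d e : ℕ}

lemma mul (hπ : Prime π) (hf : VanishesToOrder π f d) (hg : VanishesToOrder π g e) :
    VanishesToOrder π (f * g) (d + e) := by
  obtain ⟨A, B, hB, hA⟩ := hf
  obtain ⟨C, D, hD, hC⟩ := hg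
  refine ⟨A * C, B * D, hπ.not_dvd_mul hB hD, ?_⟩
  rw [map_mul, mul_mul_mul_comm, hA, hC, ← map_mul]
  congr 1
  ring

lemma pow (hπ : Prime π) (hf : VanishesToOrder π f d) (e : ℕ) :
    VanishesToOrder π (f ^ e) (e * d) := by
  induction e with
  | zero => exact ⟨1, 1, hπ.not_dvd_one, by simp⟩
  | succ e ih =>
    rw [pow_succ, Nat.succ_mul]
    exact ih.mul hπ hf

lemma pow_add_dvd [IsDomain R] [FaithfulSMul R K] (hπ : Prime π) (hf : VanishesToOrder π f e)
    {A B : R} (h : f * algebraMap R K B = algebraMap R K A) (hB : π ^ d ∣ B) :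
    π ^ (d + e) ∣ A := by
  obtain ⟨C, D, hD, hC⟩ := hf
  have hAD : A * D = B * (π ^ e * C) := by
    apply FaithfulSMul.algebraMap_injective R K
    rw [map_mul, map_mul, ← h, ← hC]
    ring
  refine hπ.pow_dvd_of_dvd_mul_right _ hD ?_
  rw [hAD, pow_add]
  exact mul_dvd_mul hB (dvd_mul_right _ _)

end VanishesToOrder

lemma vanishesToOrder_one_of_mem_valueAt {n : ℕ} (hn : 0 < n) {L : Type*} [Field L] [CharZero L]
    {ζ : L} (hζ : IsPrimitiveRoot ζ n) {f : RatFunc ℚ} (h : (f, (0 : L)) ∈ valueAt ℚ ζ) :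
    VanishesToOrder (cyclotomic n ℚ) f 1 := by
  obtain ⟨A, B, hB, hfB, hA⟩ := h
  have hB' : aeval ζ B ≠ 0 := nonZeroDivisors.ne_zero hB
  have hA' : aeval ζ A = 0 := hA.symm.trans (zero_mul _)
  have hΦ := cyclotomic_eq_minpoly_rat hζ hn
  obtain ⟨C, rfl⟩ : cyclotomic n ℚ ∣ A := hΦ ▸ minpoly.dvd ℚ ζ hA'
  refine ⟨C, B, ?_, by rw [pow_one, ← hfB]⟩
  rintro ⟨D, rfl⟩
  exact hB' (by rw [map_mul, hΦ, minpoly.aeval, zero_mul])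

lemma vanishesToOrder_five_sum_diffTerm {n m : ℕ} (hn : 0 < n) (hodd : Odd (3 * n + 1))
    (hnm : n ≤ m) (hm : m < 3 * n + 1) : VanishesToOrder (cyclotomic (3 * n + 1) ℚ)
      (∑ k ∈ Finset.range (m + 1), diffTerm (qNum (RatFunc.X : RatFunc ℚ)) (3 * n + 1) k) 5 := by
  obtain ⟨ζ, hζ⟩ : ∃ ζ : ℂ, IsPrimitiveRoot ζ (3 * n + 1) :=
    ⟨_, Complex.isPrimitiveRoot_exp (3 * n + 1) (by omega)⟩
  have hΦ : Prime (cyclotomic (3 * n + 1) ℚ) := (cyclotomic.irreducible_rat (by omega)).prime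
  obtain ⟨G, hsum, hG⟩ := exists_sum_diffTerm_eq (k := ℚ) hn hodd hζ hnm hm
  have hN := vanishesToOrder_one_of_mem_valueAt (by omega) hζ
    (qNum_three_mul_add_one_mem_valueAt hn hodd hζ)
  rw [hsum]
  change VanishesToOrder _ _ (4 * 1 + 1)
  exact (hN.pow hΦ 4).mul hΦ (vanishesToOrder_one_of_mem_valueAt (by omega) hζ hG)

lemma vanishesToOrder_one_sum_diffTerm {P n m : ℕ} (hP : 1 < P) (hodd : Odd P)
    (hPn : P ∣ 3 * n + 1) (hm : m = n ∨ m = 3 * n) : VanishesToOrder (cyclotomic P ℚ)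
      (∑ k ∈ Finset.range (m + 1), diffTerm (qNum (RatFunc.X : RatFunc ℚ)) (3 * n + 1) k) 1 := by
  have hζ := Complex.isPrimitiveRoot_exp P (by omega)
  have hlt : n % P < P := Nat.mod_lt n (by omega)
  have hmod : P ∣ 3 * (n % P) + 1 := by
    rw [← Nat.modEq_zero_iff_dvd] at hPn ⊢
    exact (((Nat.mod_modEq n P).mul_left 3).add_right 1).trans hPn
  refine vanishesToOrder_one_of_mem_valueAt (by omega) hζ ?_
  have block_mem (a : ℕ) {l : ℕ} (hl : n % P < l) (hlP : l ≤ P) :=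
    sum_diffTerm_mem_valueAt (k := ℚ) hP hodd hζ hmod hlt (N := 3 * n + 1)
      (by exact_mod_cast hPn) (by omega) a hl hlP
  rcases hm with rfl | rfl
  · have h := block_mem (m / P) (Nat.lt_succ_self _) hlt
    rwa [Nat.succ_eq_add_one, ← add_assoc, Nat.div_add_mod'] at h
  · obtain ⟨a, ha⟩ := hPn
    have h := block_mem (a - 1) hlt le_rfl
    rwa [← Nat.succ_mul, Nat.succ_eq_add_one, Nat.sub_add_cancel (by lia), mul_comm a, ← ha] at h

end VanishesToOrder

section Cyclotomic
variable {p s : ℕ} [hp : Fact p.Prime]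

lemma prod_cyclotomic_mul_X_sub_one (v : ℕ) :
    (∏ j ∈ Finset.range v, cyclotomic (p ^ (j + 1)) ℤ) * (X - 1) = X ^ p ^ v - 1 := by
  induction v with
  | zero => simp
  | succ v ih =>
    rw [Finset.prod_range_succ, mul_right_comm, ih, mul_comm,
      cyclotomic_prime_pow_mul_X_pow_sub_one]

lemma eval_one_prod_cyclotomic_pow (d : ℕ → ℕ) :
    (∏ j ∈ Finset.range s, cyclotomic (p ^ (j + 1)) ℤ ^ d j).eval 1 =
      (p : ℤ) ^ ∑ j ∈ Finset.range s, d j := by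
  simp only [eval_prod, eval_pow, eval_one_cyclotomic_prime_pow, Finset.prod_pow_eq_pow_sum]

lemma prod_cyclotomic_pow_dvd (d : ℕ → ℕ) {A : ℤ[X]}
    (h : ∀ j < s, cyclotomic (p ^ (j + 1)) ℚ ^ d j ∣ A.map (Int.castRingHom ℚ)) :
    (∏ j ∈ Finset.range s, cyclotomic (p ^ (j + 1)) ℤ ^ d j) ∣ A := by
  rw [← Polynomial.map_dvd_map (Int.castRingHom ℚ) Int.cast_injective
    (monic_prod_of_monic _ _ fun j _ => (cyclotomic.monic _ ℤ).pow _), Polynomial.map_prod]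
  simp only [Polynomial.map_pow, map_cyclotomic_int]
  refine Finset.prod_dvd_of_coprime (fun i _ j _ hij => ?_) fun j hj => h j (Finset.mem_range.1 hj)
  have hpow : p ^ (i + 1) ≠ p ^ (j + 1) :=
    (Nat.pow_right_injective hp.out.two_le).ne (by simpa using hij)
  exact (cyclotomic.isCoprime_rat hpow).pow

lemma not_intCast_dvd_one : ¬ (p : ℤ) ∣ 1 := (Nat.prime_iff_prime_int.1 hp.out).not_dvd_one

/-- The integer polynomials that become prime to `p` at `1` after division by powers of the
cyclotomic polynomials of order `p, …, p ^ s`. -/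
def cyclotomicDenominators (p s : ℕ) [hp : Fact p.Prime] : Submonoid ℤ[X] where
  carrier := {B | ∃ (d : ℕ → ℕ) (C : ℤ[X]), ¬ (p : ℤ) ∣ C.eval 1 ∧
    B = (∏ j ∈ Finset.range s, cyclotomic (p ^ (j + 1)) ℤ ^ d j) * C}
  one_mem' := ⟨0, 1, by simpa using not_intCast_dvd_one, by simp⟩
  mul_mem' := by
    rintro _ _ ⟨d, B, hB, rfl⟩ ⟨e, C, hC, rfl⟩
    refine ⟨d + e, B * C, ?_, ?_⟩
    · rw [eval_mul]
      exact (Nat.prime_iff_prime_int.1 hp.out).not_dvd_mul hB hC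
    · simp only [Pi.add_apply, pow_add, Finset.prod_mul_distrib]
      ring

lemma mem_cyclotomicDenominators_of_not_dvd {B : ℤ[X]} (hB : ¬ (p : ℤ) ∣ B.eval 1) :
    B ∈ cyclotomicDenominators p s := ⟨0, B, hB, by simp⟩

lemma cyclotomic_mem_cyclotomicDenominators {j : ℕ} (hj : j < s) :
    cyclotomic (p ^ (j + 1)) ℤ ∈ cyclotomicDenominators p s := by
  refine ⟨Pi.single j 1, 1, by simpa using not_intCast_dvd_one, ?_⟩
  rw [mul_one, Finset.prod_eq_single_of_mem j (Finset.mem_range.2 hj) fun i _ hij => by simp [hij],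
    Pi.single_eq_same, pow_one]

lemma expand_two_cyclotomic_mem_cyclotomicDenominators (hp2 : p ≠ 2) {j : ℕ} (hj : j < s) :
    expand ℤ 2 (cyclotomic (p ^ (j + 1)) ℤ) ∈ cyclotomicDenominators p s := by
  have h2 : ¬ 2 ∣ p ^ (j + 1) := fun h =>
    hp2 ((Nat.prime_dvd_prime_iff_eq Nat.prime_two hp.out).1
      (Nat.prime_two.dvd_of_dvd_pow h)).symm
  have hexpand := cyclotomic_expand_eq_cyclotomic_mul Nat.prime_two h2 ℤ
  have heval : (cyclotomic (p ^ (j + 1) * 2) ℤ).eval 1 = 1 := by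
    have h := congrArg (eval 1) hexpand
    rw [expand_eval, one_pow, eval_mul, eval_one_cyclotomic_prime_pow] at h
    exact (right_eq_mul₀ (mod_cast hp.out.ne_zero)).1 h
  rw [hexpand]
  refine mul_mem (mem_cyclotomicDenominators_of_not_dvd ?_)
    (cyclotomic_mem_cyclotomicDenominators hj)
  rw [heval]
  exact not_intCast_dvd_one

lemma geom_sum_sq_pow_mul_eq (v y : ℕ) : ∑ i ∈ Finset.range (p ^ v * y), ((X : ℤ[X]) ^ 2) ^ i =
    (∏ j ∈ Finset.range v, expand ℤ 2 (cyclotomic (p ^ (j + 1)) ℤ)) *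
      ∑ i ∈ Finset.range y, (((X : ℤ[X]) ^ 2) ^ p ^ v) ^ i := by
  have hprod := congrArg (expand ℤ 2) (prod_cyclotomic_mul_X_sub_one (p := p) v)
  simp only [map_mul, map_prod, map_sub, map_one, map_pow, expand_X] at hprod
  have hX : (X : ℤ[X]) ^ 2 - 1 ≠ 0 := by
    simpa using X_pow_sub_C_ne_zero (R := ℤ) two_pos 1
  apply mul_right_cancel₀ hX
  rw [geom_sum_mul, mul_right_comm, hprod, mul_comm (_ - 1), geom_sum_mul, ← pow_mul (X ^ 2)]

lemma geom_sum_sq_mem_cyclotomicDenominators (hp2 : p ≠ 2) {n : ℕ} (hn0 : n ≠ 0)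
    (hn : ¬ p ^ (s + 1) ∣ n) :
    ∑ i ∈ Finset.range n, ((X : ℤ[X]) ^ 2) ^ i ∈ cyclotomicDenominators p s := by
  obtain ⟨v, y, hy, rfl⟩ := Nat.exists_eq_pow_mul_and_not_dvd hn0 p hp.out.ne_one
  have hv : v ≤ s := by
    by_contra! hsv
    exact hn ((pow_dvd_pow p hsv).mul_right y)
  rw [geom_sum_sq_pow_mul_eq]
  refine mul_mem (prod_mem fun j hj => expand_two_cyclotomic_mem_cyclotomicDenominators hp2
    ((Finset.mem_range.1 hj).trans_le hv)) (mem_cyclotomicDenominators_of_not_dvd ?_)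
  simp only [eval_finsetSum, eval_pow, eval_X, one_pow, Finset.sum_const, Finset.card_range,
    nsmul_eq_mul, mul_one]
  exact_mod_cast hy

end Cyclotomic

section ValueAtOne
variable {p s : ℕ} [hp : Fact p.Prime]

/-- The pairs `(f, f(1))`, where `f` is a quotient of integer polynomials whose denominator lies in
`cyclotomicDenominators p s`. -/
noncomputable def integralValueAtOne (p s : ℕ) [Fact p.Prime] : Subring (RatFunc ℚ × ℚ) :=
  specialization ((algebraMap ℚ[X] (RatFunc ℚ)).comp (mapRingHom (Int.castRingHom ℚ)))
    ((Int.castRingHom ℚ).comp (evalRingHom 1)) (cyclotomicDenominators p s)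

lemma qNum_succ_mul_X_pow (n : ℕ) : qNum (RatFunc.X : RatFunc ℚ) (n + 1 : ℕ) *
    algebraMap ℚ[X] (RatFunc ℚ) ((X ^ n : ℤ[X]).map (Int.castRingHom ℚ)) =
      algebraMap ℚ[X] (RatFunc ℚ)
        ((∑ i ∈ Finset.range (n + 1), ((X : ℤ[X]) ^ 2) ^ i).map (Int.castRingHom ℚ)) := by
  simpa [Polynomial.map_sum] using
    qNum_succ_mul_pow RatFunc.X_ne_zero (ratFuncX_sq_ne_one ℚ) n

lemma qNum_mem_integralValueAtOne (x : ℤ) : (qNum RatFunc.X x, (x : ℚ)) ∈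
    integralValueAtOne p s := by
  have natCast_mem (n : ℕ) : (qNum RatFunc.X n, (n : ℚ)) ∈ integralValueAtOne p s := by
    rcases n with _ | n
    · rw [Nat.cast_zero, Nat.cast_zero, qNum_zero]
      exact zero_mem _
    · refine ⟨∑ i ∈ Finset.range (n + 1), (X ^ 2) ^ i, X ^ n,
        mem_cyclotomicDenominators_of_not_dvd ?_, qNum_succ_mul_X_pow n, by simp⟩
      simpa using not_intCast_dvd_one
  obtain ⟨n, rfl | rfl⟩ := x.eq_nat_or_neg
  · exact_mod_cast natCast_mem n
  · simpa [qNum_neg] using neg_mem (natCast_mem n)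

lemma inv_qNum_mem_integralValueAtOne (hp2 : p ≠ 2) {x : ℤ} (hx0 : x ≠ 0)
    (hx : ¬ (p : ℤ) ^ (s + 1) ∣ x) :
    ((qNum RatFunc.X x)⁻¹, (x : ℚ)⁻¹) ∈ integralValueAtOne p s := by
  have natCast_mem (n : ℕ) (h0 : n ≠ 0) (h : ¬ p ^ (s + 1) ∣ n) :
      ((qNum RatFunc.X n)⁻¹, (n : ℚ)⁻¹) ∈ integralValueAtOne p s := by
    obtain ⟨n, rfl⟩ := Nat.exists_eq_add_one_of_ne_zero h0
    refine ⟨X ^ n, ∑ i ∈ Finset.range (n + 1), (X ^ 2) ^ i,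
      geom_sum_sq_mem_cyclotomicDenominators hp2 h0 h, ?_, ?_⟩
    · have hq : qNum (RatFunc.X : RatFunc ℚ) (n + 1 : ℕ) ≠ 0 := by
        rw [Ne, qNum_X_eq_zero_iff]
        omega
      exact (inv_mul_eq_iff_eq_mul₀ hq).2 (qNum_succ_mul_X_pow n).symm
    · have hn : (n + 1 : ℚ) ≠ 0 := n.cast_add_one_ne_zero
      simp [hn]
  obtain ⟨n, rfl | rfl⟩ := x.eq_nat_or_neg
  · exact_mod_cast natCast_mem n (mod_cast hx0) (mod_cast hx)
  · rw [dvd_neg] at hx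
    simpa only [qNum_neg, inv_neg, Int.cast_neg, Int.cast_natCast, Prod.neg_mk] using
      neg_mem (natCast_mem n (mod_cast neg_ne_zero.1 hx0) (mod_cast hx))

/-- The source of the powers of `p`: a factor `Φ_{p ^ j}` of the numerator contributes
`Φ_{p ^ j}(1) = p`. -/
theorem exists_eq_pow_mul_of_vanishesToOrder {f : RatFunc ℚ} {c : ℚ}
    (hf : (f, c) ∈ integralValueAtOne p s) (e : ℕ → ℕ)
    (he : ∀ j < s, VanishesToOrder (cyclotomic (p ^ (j + 1)) ℚ) f (e j)) :
    ∃ r ∈ (Rat.padicValuation p).integer, c = (p : ℚ) ^ (∑ j ∈ Finset.range s, e j) * r := by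
  obtain ⟨A, _, ⟨d, B, hB, rfl⟩, hA, hc⟩ := hf
  obtain ⟨C, rfl⟩ : (∏ j ∈ Finset.range s, cyclotomic (p ^ (j + 1)) ℤ ^ (d j + e j)) ∣ A := by
    refine prod_cyclotomic_pow_dvd _ fun j hj => (he j hj).pow_add_dvd
      (cyclotomic.irreducible_rat (pow_pos hp.out.pos _)).prime hA ?_
    rw [coe_mapRingHom, ← map_cyclotomic_int, ← Polynomial.map_pow]
    exact Polynomial.map_dvd _
      ((Finset.dvd_prod_of_mem _ (Finset.mem_range.2 hj)).mul_right B)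
  simp only [RingHom.comp_apply, coe_evalRingHom, eval_mul, eval_one_prod_cyclotomic_pow,
    eq_intCast, Int.cast_mul, Int.cast_pow, Int.cast_natCast] at hc
  rw [Finset.sum_add_distrib, pow_add] at hc
  have hB0 : ((B.eval 1 : ℤ) : ℚ) ≠ 0 := Int.cast_ne_zero.2 fun h => hB (h ▸ dvd_zero _)
  have hp0 : (p : ℚ) ^ (∑ j ∈ Finset.range s, d j) ≠ 0 :=
    pow_ne_zero _ (Nat.cast_ne_zero.2 hp.out.ne_zero)
  refine ⟨(C.eval 1 : ℤ) * ((B.eval 1 : ℤ) : ℚ)⁻¹,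
    mul_mem (intCast_mem _ _) (inv_intCast_mem_integer hB), ?_⟩
  rw [← mul_assoc, eq_mul_inv_iff_mul_eq₀ hB0]
  apply mul_left_cancel₀ hp0
  linear_combination hc

end ValueAtOne

section SecondDifference
variable {p s : ℕ} [hp : Fact p.Prime]

lemma ratioProd_mem_integralValueAtOne (hp2 : p ≠ 2) {x y : ℤ} {k : ℕ}
    (hy : ∀ i < k, (3 * i + y : ℤ) ≠ 0 ∧ ¬ (p : ℤ) ^ (s + 1) ∣ 3 * i + y) :
    (ratioProd (qNum RatFunc.X) x y k, ratioProd Int.cast x y k) ∈ integralValueAtOne p s :=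
  ratioProd_pair_mem (fun _ _ => qNum_mem_integralValueAtOne _)
    fun i hi => inv_qNum_mem_integralValueAtOne hp2 (hy i hi).1 (hy i hi).2

lemma sum_diffTerm_mem_integralValueAtOne (hp5 : 5 ≤ p) {n m : ℕ} (hN : p ^ s = 3 * n + 1)
    (hm : m ≤ 3 * n) :
    (∑ k ∈ Finset.range (m + 1), diffTerm (qNum RatFunc.X) (3 * n + 1) k,
      ∑ k ∈ Finset.range (m + 1), diffTerm (Int.cast : ℤ → ℚ) (3 * n + 1) k) ∈
        integralValueAtOne p s := by
  have not_dvd {x : ℤ} (hx0 : x ≠ 0) (hx : |x| < 4 * (3 * n + 1)) : ¬ (p : ℤ) ^ (s + 1) ∣ x := by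
    refine fun hdvd => hx0 (Int.eq_zero_of_abs_lt_dvd hdvd (hx.trans_le ?_))
    have hNz : (p : ℤ) ^ s = 3 * n + 1 := mod_cast hN
    rw [pow_succ, hNz, mul_comm]
    gcongr
    omega
  have ratio_mem {k : ℕ} (hk : k ≤ m) (c : ℤ) (hc : c = 0 ∨ c = 3 * n + 1 ∨ c = -(3 * n + 1)) :
      (ratioProd (qNum RatFunc.X) (1 + c) (3 + c) k, ratioProd Int.cast (1 + c) (3 + c) k) ∈
        integralValueAtOne p s := by
    refine ratioProd_mem_integralValueAtOne (by omega) fun i hi => ?_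
    have h0 : (3 * i + (3 + c) : ℤ) ≠ 0 := by omega
    exact ⟨h0, not_dvd h0 (abs_lt.2 (by omega))⟩
  refine sum_pair_mem fun k hk => ?_
  have hkm : k ≤ m := Finset.mem_range_succ_iff.1 hk
  exact diffTerm_pair_mem (qNum_mem_integralValueAtOne _)
    (by simpa only [add_zero] using ratio_mem hkm 0 (by simp)) (ratio_mem hkm _ (by simp))
    (by simpa only [← sub_eq_add_neg] using ratio_mem hkm _ (.inr (.inr rfl)))

theorem exists_sum_diffTerm_intCast_eq (hp5 : 5 ≤ p) {n m : ℕ} (hN : p ^ (s + 1) = 3 * n + 1)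
    (hm : m = n ∨ m = 3 * n) : ∃ r ∈ (Rat.padicValuation p).integer,
      ∑ k ∈ Finset.range (m + 1), diffTerm Int.cast (3 * n + 1) k = (p : ℚ) ^ (s + 5) * r := by
  have hodd : Odd p := hp.out.odd_of_ne_two (by omega)
  have hpN : p ≤ 3 * n + 1 := hN ▸ Nat.le_self_pow s.succ_ne_zero p
  have order (j : ℕ) (hj : j < s + 1) : VanishesToOrder (cyclotomic (p ^ (j + 1)) ℚ)
      (∑ k ∈ Finset.range (m + 1), diffTerm (qNum (RatFunc.X : RatFunc ℚ)) (3 * n + 1) k)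
        (if j = s then 5 else 1) := by
    split_ifs with hjs
    · rw [hjs, hN]
      exact vanishesToOrder_five_sum_diffTerm (by omega) (hN ▸ hodd.pow) (by omega) (by omega)
    · exact vanishesToOrder_one_sum_diffTerm (Nat.one_lt_pow j.succ_ne_zero hp.out.one_lt)
        hodd.pow (hN ▸ pow_dvd_pow p hj) hm
  obtain ⟨r, hr, hsum⟩ := exists_eq_pow_mul_of_vanishesToOrder
    (sum_diffTerm_mem_integralValueAtOne hp5 hN (by omega)) _ order
  have hexp : ∑ j ∈ Finset.range (s + 1), (if j = s then 5 else 1) = s + 5 := by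
    rw [Finset.sum_range_succ, if_pos rfl, Finset.sum_congr rfl fun j hj =>
      if_neg (Finset.mem_range.1 hj).ne]
    simp
  exact ⟨r, hr, hexp ▸ hsum⟩

end SecondDifference

section Series

lemma shiftedFactorial_div_factorial (a : ℤ) (k : ℕ) :
    shiftedFactorial (a / 3) k / k.factorial = ratioProd Int.cast a 3 k := by
  induction k with
  | zero => simp [shiftedFactorial]
  | succ k ih =>
    rw [ratioProd_succ, ← ih, shiftedFactorial, shiftedFactorial, ascPochhammer_succ_eval,
      Nat.factorial_succ]
    push_cast
    field_simp
    ring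

lemma shiftedFactorial_one (n : ℕ) : shiftedFactorial 1 n = n.factorial :=
  ascPochhammer_eval_one ℚ n

lemma sum_range_mul_eq {n m : ℕ} (hnm : n ≤ m) {t : ℚ} (ht : ∀ i : ℕ, (3 * i + 3 : ℚ) ^ 2 - t ≠ 0) :
    ∑ k ∈ Finset.range (m + 1), (6 * k + 1) * pairedProd Int.cast 0 1 k *
      pairedProd Int.cast t 1 k * pairedProd Int.cast ((3 * n + 1 : ℚ) ^ 2) 1 k =
    (3 * n + 1) * ratioProd Int.cast 2 3 n * pairedProd Int.cast t 2 n := by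
  rw [← dougall_sum ht]
  refine (Finset.sum_subset (Finset.range_mono (by omega)) fun k _ hk => ?_).symm
  rw [pairedProd_intCast_eq_zero (by simpa using hk), mul_zero]

/-- With `A = pairedProd 0 1 k` and `B = pairedProd (N ^ 2) 1 k`, the expansion
`A³ = 2 A² B - A B² + A (A - B)²` leaves two series that Dougall's formula sums. -/
lemma sum_mul_ratioProd_pow_six_eq {n m : ℕ} (hnm : n ≤ m) :
    ∑ k ∈ Finset.range (m + 1), (6 * k + 1) * ratioProd (Int.cast : ℤ → ℚ) 1 3 k ^ 6 =
      (3 * n + 1 : ℚ) * ratioProd Int.cast 2 3 n *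
        (2 * ratioProd Int.cast 2 3 n ^ 2 - pairedProd Int.cast ((3 * n + 1 : ℚ) ^ 2) 2 n) +
      ∑ k ∈ Finset.range (m + 1), diffTerm Int.cast (3 * n + 1) k := by
  have hN (i : ℕ) : (3 * i + 3 : ℚ) ^ 2 - (3 * n + 1) ^ 2 ≠ 0 := by
    have hadd : (3 * i + 3 + (3 * n + 1) : ℚ) ≠ 0 := by positivity
    have hsub : (3 * i + 3 - (3 * n + 1) : ℚ) ≠ 0 := by
      exact_mod_cast (by omega : (3 * i + 3 - (3 * n + 1) : ℤ) ≠ 0)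
    rw [sq_sub_sq]
    exact mul_ne_zero hadd hsub
  have sum_zero := sum_range_mul_eq hnm (t := 0) fun i => by rw [sub_zero]; positivity
  have sum_sq := sum_range_mul_eq hnm hN
  rw [pairedProd_zero_left] at sum_zero
  rw [mul_sub, mul_left_comm _ 2, ← sum_zero, ← sum_sq, Finset.mul_sum, ← Finset.sum_sub_distrib,
    ← Finset.sum_add_distrib]
  refine Finset.sum_congr rfl fun k _ => ?_
  have hpair := ratioProd_mul_ratioProd (b := (Int.cast : ℤ → ℚ))
    (fun x y => by push_cast; ring) 1 (3 * n + 1) k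
  push_cast at hpair
  rw [diffTerm, hpair, pairedProd_zero_left]
  push_cast
  ring

variable {p s : ℕ} [hp : Fact p.Prime]

lemma padicValuation_sq_mul_lt_one {d : ℚ} (hd : d ∈ (Rat.padicValuation p).integer) :
    Rat.padicValuation p ((p : ℚ) ^ 2 * d) < 1 := by
  rw [map_mul, map_pow, Rat.padicValuation_self]
  have hexp : WithZero.exp (-1 : ℤ) < 1 := WithZero.exp_lt_exp.2 (by norm_num)
  exact mul_lt_one_of_lt_of_le (pow_lt_one' hexp two_ne_zero) hd

lemma exists_pairedProd_intCast_eq {n : ℕ} (hN : p ^ (s + 1) = 3 * n + 1) :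
    ∃ r ∈ (Rat.padicValuation p).integer, pairedProd Int.cast ((3 * n + 1 : ℚ) ^ 2) 2 n =
      ratioProd Int.cast 2 3 n ^ 2 *
        (1 + (3 * n + 1) ^ 2 * pairedProdLogDeriv Int.cast 2 n + (p : ℚ) ^ 4 * r) := by
  have regular {x : ℕ} (hx0 : 0 < x) (hx : x < 3 * n + 1) :
      (x : ℚ) ≠ 0 ∧ ((p : ℚ) ^ s) ^ 2 / x ^ 2 ∈ (Rat.padicValuation p).integer :=
    ⟨mod_cast hx0.ne', div_pow ((p : ℚ) ^ s) x 2 ▸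
      pow_mem (pow_pred_div_mem_integer (s := s + 1) hx0 (hN ▸ hx)) 2⟩
  obtain ⟨r, hr, h⟩ := exists_pairedProd_eq (S := (Rat.padicValuation p).integer)
    (b := Int.cast) (w := ((p : ℚ) ^ s) ^ 2) (x := 2) (k := n) (pow_mem (natCast_mem _ p) 2)
    (fun d hd => one_sub_inv_mem_integer (padicValuation_sq_mul_lt_one hd))
    (fun i hi => by simpa using regular (x := 3 * i + 2) (by omega) (by omega))
    (fun i hi => by simpa using regular (x := 3 * i + 3) (by omega) (by omega))
  have hNq : (3 * n + 1 : ℚ) ^ 2 = (p : ℚ) ^ 2 * ((p : ℚ) ^ s) ^ 2 := by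
    rw [← mul_pow, ← pow_succ']
    exact_mod_cast congrArg (· ^ 2) hN.symm
  exact ⟨r, hr, by rw [hNq, h, ← pow_mul (p : ℚ) 2 2]⟩

lemma ratioProd_two_three_mem_integer (hp3 : p ≠ 3) (n : ℕ) :
    ratioProd Int.cast 2 3 n ∈ (Rat.padicValuation p).integer := by
  rw [← shiftedFactorial_div_factorial, div_eq_mul_inv (_ : ℚ) 3]
  refine ascPochhammer_eval_div_factorial_mem_integer (mul_mem (intCast_mem _ _) ?_) n
  refine mod_cast inv_intCast_mem_integer (b := 3) ?_
  exact mod_cast mt (Nat.prime_dvd_prime_iff_eq hp.out Nat.prime_three).1 hp3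

theorem exists_sum_sub_eq (hp5 : 5 ≤ p) {n m : ℕ} (hN : p ^ (s + 1) = 3 * n + 1)
    (hm : m = n ∨ m = 3 * n) : ∃ r ∈ (Rat.padicValuation p).integer,
      ∑ k ∈ Finset.range (m + 1), (6 * k + 1) * ratioProd (Int.cast : ℤ → ℚ) 1 3 k ^ 6 -
        ratioProd Int.cast 2 3 n ^ 3 *
          ((p : ℚ) ^ (s + 1) - (p : ℚ) ^ (3 * (s + 1)) * pairedProdLogDeriv Int.cast 2 n) =
      (p : ℚ) ^ (s + 5) * r := by
  obtain ⟨u, hu, hdiff⟩ := exists_sum_diffTerm_intCast_eq hp5 hN hm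
  obtain ⟨v, hv, hpaired⟩ := exists_pairedProd_intCast_eq hN
  refine ⟨u - ratioProd Int.cast 2 3 n ^ 3 * v,
    sub_mem hu (mul_mem (pow_mem (ratioProd_two_three_mem_integer (by omega) n) 3) hv), ?_⟩
  have hNq : (p : ℚ) ^ (s + 1) = 3 * n + 1 := mod_cast hN
  rw [sum_mul_ratioProd_pow_six_eq (by omega : n ≤ m), hdiff, hpaired, mul_comm 3 (s + 1), pow_mul,
    show s + 5 = s + 1 + 4 from rfl, pow_add, hNq]
  ring

lemma sum_Icc_eq_neg_pairedProdLogDeriv (n : ℕ) :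
    ∑ j ∈ Finset.Icc 1 n, (1 / (3 * (j : ℚ) - 1) ^ 2 - 1 / (3 * (j : ℚ)) ^ 2) =
      -pairedProdLogDeriv Int.cast 2 n := by
  induction n with
  | zero => simp [pairedProdLogDeriv]
  | succ n ih =>
    rw [Finset.sum_Icc_succ_top (by omega), ih, pairedProdLogDeriv_succ]
    push_cast
    ring_nf

end Series

lemma five_le_of_odd_of_pow_eq {p s n : ℕ} (hp : p.Prime) (hodd : Odd p)
    (hN : p ^ (s + 1) = 3 * n + 1) : 5 ≤ p := by
  have h2 := hp.two_le
  by_contra! h5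
  interval_cases p
  · exact absurd hodd (by decide)
  · rw [pow_succ] at hN
    omega
  · exact absurd hodd (by decide)

theorem corollary1p5 (p s m : ℕ) (hp : p.Prime) (hodd : Odd p) (hs : 1 ≤ s)
    (hps : p ^ s ≡ 1 [MOD 3]) (hm : m = (p ^ s - 1) / 3 ∨ m = p ^ s - 1) :
    RatModEqPrimePow p (s + 4)
      (∑ k ∈ Finset.range (m + 1),
        (6 * (k : ℚ) + 1) * (shiftedFactorial (1 / 3) k ^ 6 / (k.factorial : ℚ) ^ 6))
      (shiftedFactorial (2 / 3) ((p ^ s - 1) / 3) ^ 3 / shiftedFactorial 1 ((p ^ s - 1) / 3) ^ 3 *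
        ((p : ℚ) ^ s + (p : ℚ) ^ (3 * s) *
          ∑ j ∈ Finset.Icc 1 ((p ^ s - 1) / 3),
            (1 / (3 * (j : ℚ) - 1) ^ 2 - 1 / (3 * (j : ℚ)) ^ 2))) := by
  have : Fact p.Prime := ⟨hp⟩
  obtain ⟨t, rfl⟩ : ∃ t, s = t + 1 := ⟨s - 1, by omega⟩
  obtain ⟨n, hN⟩ : ∃ n, p ^ (t + 1) = 3 * n + 1 := ⟨p ^ (t + 1) / 3, by
    have : p ^ (t + 1) % 3 = 1 := hps
    omega⟩
  have hn : (p ^ (t + 1) - 1) / 3 = n := by omega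
  obtain ⟨r, hr, hsum⟩ :=
    exists_sum_sub_eq (m := m) (five_le_of_odd_of_pow_eq hp hodd hN) hN (by omega)
  refine ⟨r, not_dvd_den_iff_mem_integer.2 hr, ?_⟩
  have h₁ := shiftedFactorial_div_factorial 1
  have h₂ := shiftedFactorial_div_factorial 2
  push_cast at h₁ h₂
  simp only [hn, ← div_pow, shiftedFactorial_one, h₁, h₂, sum_Icc_eq_neg_pairedProdLogDeriv,
    mul_neg, ← sub_eq_add_neg]
  exact hsum
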